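/- **Theorem 4 (Discrete Hopf).** Let $B\subset\mathbb R^3$ be a convex polyhedron (the convex hull of finitely many points, with non-empty interior), let $P=\partial B$ be equipped with a finite triangulation $K$, and let $d$ be a metric on $P$ inducing the topology of $P$. Let $f\colon P\to\mathbb R^2$ be continuous, affine on each triangle of $K$, and in general position: the images of no three distinct vertices of $K$ lie on one line. For $p\in\operatorname{Int}B$, call $a,b\in P$ *antipodal with respect to $p$* if they are the two points where some line through $p$ meets $P$. A *center* of $(P,d)$ is a point of $\operatorname{Int}B$ at which the function $p\mapsto\inf\{d(a,b): a,b \text{ antipodal with respect to } p\}$ attains its supremum over $\operatorname{Int}B$. Let $T$ be a triangulation of $f(P)$ (for example a constrained Delaunay triangulation) whose vertices are the points where images of two distinct edges of $K$ meet, and among whose edges are all the segments into which these vertices cut the images of the edges of $K$. The induced triangulation of $P$ has as triangles the non-empty sets $\overline{s\cap f^{-1}(\operatorname{Int}t)}$, for $s$ a triangle of $K$ and $t$ a triangle of $T$. The complex of $f$-neighbors $\mathfrak F_f\subset P\times P\subset\mathbb R^3\times\mathbb R^3$ consists of the triangles $[\mathcal A,\mathcal B]=\{(a,b)\in\mathcal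 A\times\mathcal B: f(a)=f(b)\}$, with their edges and vertices, for all ordered pairs of distinct triangles $\mathcal A,\mathcal B$ of the induced triangulation with $f(\mathcal A)=f(\mathcal B)$. Then: 1. for every such $T$ and every center $p$ of $(P,d)$ there is a polygonal path inside $\mathfrak F_f$ joining a pair $(a,b)$ of points antipodal with respect to $p$ to a pair $(c,c)$ of identical points; 2. for every such $T$, the underlying set of $\mathfrak F_f$ is the closure of $\{(a,b)\in P\times P: a\ne b,\ f(a)=f(b)\}$, and so does not depend on $T$; 3. for every $p\in\operatorname{Int}B$, center or not, there is a polygonal path inside this closure joining a pair of points antipodal with respect to $p$ to a pair of identical points. -/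

import Mathlib

namespace DiscreteHopf

/-- Euclidean 3-space. -/
abbrev E3 := EuclideanSpace ℝ (Fin 3)

/-- The Euclidean plane. -/
abbrev E2 := EuclideanSpace ℝ (Fin 2)

/-- A (bounded, full-dimensional) convex polyhedron in Euclidean 3-space. -/
def IsConvexPolyhedron (B : Set E3) : Prop :=
  (∃ V : Finset E3, B = convexHull ℝ (V : Set E3)) ∧ (interior B).Nonempty

/-- `K` is a (finite, geometric) triangulation of the set `P`. -/
def IsTriangulationOf (K : Geometry.SimplicialComplex ℝ E3) (P : Set E3) : Prop :=
  K.faces.Finite ∧ K.space = P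

/-- `f` is affine on each triangle of `K`. -/
def IsAffineOnTriangles (K : Geometry.SimplicialComplex ℝ E3) (f : E3 → E2) : Prop :=
  ∀ s ∈ K.faces, s.card = 3 → ∃ g : E3 →ᵃ[ℝ] E2, Set.EqOn f g (convexHull ℝ (s : Set E3))

/-- General position: no three vertex images lie on the same line. -/
def IsGeneralPosition (K : Geometry.SimplicialComplex ℝ E3) (f : E3 → E2) : Prop :=
  ∀ u ∈ K.vertices, ∀ v ∈ K.vertices, ∀ w ∈ K.vertices,
    u ≠ v → v ≠ w → u ≠ w → ¬ Collinear ℝ ({f u, f v, f w} : Set E2)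

/-- The points where the images of two distinct edges of `K` meet. -/
def edgeCrossings (K : Geometry.SimplicialComplex ℝ E3) (f : E3 → E2) : Set E2 :=
  {y | ∃ e ∈ K.faces, ∃ e' ∈ K.faces, e.card = 2 ∧ e'.card = 2 ∧ e ≠ e' ∧
    y ∈ f '' convexHull ℝ (e : Set E3) ∧ y ∈ f '' convexHull ℝ (e' : Set E3)}

open Classical in
/-- The constraints, given by their endpoints: the segments into which the images of the edges
of `K` are cut by the points of `edgeCrossings K f`. -/
def constraints (K : Geometry.SimplicialComplex ℝ E3) (f : E3 → E2) : Set (Finset E2) :=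
  {c | ∃ e ∈ K.faces, e.card = 2 ∧ ∃ y z : E2, y ≠ z ∧ c = {y, z} ∧
    y ∈ edgeCrossings K f ∧ z ∈ edgeCrossings K f ∧
    y ∈ f '' convexHull ℝ (e : Set E3) ∧ z ∈ f '' convexHull ℝ (e : Set E3) ∧
    Disjoint (openSegment ℝ y z) (edgeCrossings K f)}

/-- `T` is a triangulation of the image of `K` under `f`, constrained by the images of the edges:
its vertices are the crossings of edge images, and the constraints are among its edges. Every
constrained Delaunay triangulation is of this kind; the Delaunay condition only singles out
particular ones and is not required. -/
structure IsImageTriangulation (K : Geometry.SimplicialComplex ℝ E3) (f : E3 → E2)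
    (T : Geometry.SimplicialComplex ℝ E2) : Prop where
  finite : T.faces.Finite
  space_eq : T.space = f '' K.space
  vertices_eq : T.vertices = edgeCrossings K f
  constraints_subset : constraints K f ⊆ T.faces

/-- The triangles of the triangulation of `K.space` induced by `f` and `T`: closures of the
preimages of the interiors of the triangles `t` of `T`, one in each triangle `s` of `K` that
meets this preimage. -/
def inducedTriangles (K : Geometry.SimplicialComplex ℝ E3) (f : E3 → E2)
    (T : Geometry.SimplicialComplex ℝ E2) : Set (Set E3) :=
  {A | A.Nonempty ∧ ∃ s ∈ K.faces, s.card = 3 ∧ ∃ t ∈ T.faces, t.card = 3 ∧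
    A = closure (convexHull ℝ (s : Set E3) ∩ f ⁻¹' interior (convexHull ℝ (t : Set E2)))}

/-- The triangle `[A, B]` of corresponding `f`-neighbors. -/
def neighborTriangle (f : E3 → E2) (A B : Set E3) : Set (E3 × E3) :=
  {x | x.1 ∈ A ∧ x.2 ∈ B ∧ f x.1 = f x.2}

/-- The triangles of the complex of `f`-neighbors. -/
def neighborTriangles (K : Geometry.SimplicialComplex ℝ E3) (f : E3 → E2)
    (T : Geometry.SimplicialComplex ℝ E2) : Set (Set (E3 × E3)) :=
  {N | ∃ A ∈ inducedTriangles K f T, ∃ B ∈ inducedTriangles K f T,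
    A ≠ B ∧ f '' A = f '' B ∧ N = neighborTriangle f A B}

/-- The underlying space of the complex of `f`-neighbors; the edges and vertices of the complex
are those of its triangles, so that they add no points. -/
def neighborComplex (K : Geometry.SimplicialComplex ℝ E3) (f : E3 → E2)
    (T : Geometry.SimplicialComplex ℝ E2) : Set (E3 × E3) :=
  ⋃₀ neighborTriangles K f T

/-- The pairs of distinct `f`-neighbors in `P`. -/
def distinctNeighbors (P : Set E3) (f : E3 → E2) : Set (E3 × E3) :=
  {x | x.1 ∈ P ∧ x.2 ∈ P ∧ x.1 ≠ x.2 ∧ f x.1 = f x.2}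

/-- `a` and `b` are antipodal with respect to the point `p` (of the interior of `B`): they are the
two points where some line through `p` meets the boundary of `B`. -/
def Antipodal (B : Set E3) (p a b : E3) : Prop :=
  a ∈ frontier B ∧ b ∈ frontier B ∧ p ∈ openSegment ℝ a b

/-- The infimum of the distances of antipodal points with respect to `p`. -/
noncomputable def antipodalDist (B : Set E3) (d : MetricSpace (frontier B)) (p : E3) : ℝ :=
  sInf {r | ∃ a b : frontier B, Antipodal B p a b ∧ r = d.dist a b}

/-- `p` is a center of the boundary of `B` with the metric `d`: an interior point at which the
supremum of `antipodalDist` over the interior is achieved. -/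
def IsCenter (B : Set E3) (d : MetricSpace (frontier B)) (p : E3) : Prop :=
  p ∈ interior B ∧ IsMaxOn (antipodalDist B d) (interior B) p

/-- There is a polygonal path inside `S` with vertices `v 0 = x, v 1, …, v n = y`. -/
def PolygonallyJoined (S : Set (E3 × E3)) (x y : E3 × E3) : Prop :=
  ∃ (n : ℕ) (v : ℕ → E3 × E3), v 0 = x ∧ v n = y ∧ x ∈ S ∧
    ∀ i < n, segment ℝ (v i) (v (i + 1)) ⊆ S

/-- A polygonal path inside `S` joins a pair of points antipodal with respect to `p` to a pair of
identical points. -/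
def JoinsAntipodalToDiagonal (B : Set E3) (p : E3) (S : Set (E3 × E3)) : Prop :=
  ∃ a b c : E3, Antipodal B p a b ∧ PolygonallyJoined S (a, b) (c, c)

end DiscreteHopf

/-! Let `F` be the closure of the set of pairs of distinct neighbors. General position makes `F` a
finite union of closed convex pieces, one for each ordered pair of distinct triangles of `K` with
overlapping images (`closure_distinctNeighbors_eq`). Let `F₁` be the part of `F` that polygonal
paths reach from antipodal pairs, and `F₂` the rest. Both are unions of pieces, hence closed, and
both are invariant under swapping. If no path reached the diagonal, `F₁` would miss the diagonal,
while `F₂` contains no antipodal pair. `false_of_separated_neighbors` excludes this.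

For an orthonormal pair `(m, v)` and `θ` in `[0, 1]`, project `(1 - θ) m - θ v` and `(1 - θ) m + θ
v` from `p` to the boundary. The resulting pair is diagonal at `θ = 0` and antipodal at `θ = 1`. The
difference of its `f`-values is a complex function `G` on the frames, odd under `v ↦ -v`, and for `θ
> 0` its zeros come from `F₁` or `F₂`. Write `G = E * H` with `E` even and vanishing exactly on the
first part, `H` odd and vanishing exactly on the second. For small `θ` the first part is empty and
`E = 1` works. Since the two parts stay disjoint, the factorization survives up to `θ = 1`
(`HasParityFactorization.of_homotopy`), where `H` has no zeros. But the space of frames is the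
rotation group: along the loop that turns `v` around `m`, an odd nonvanishing function has odd
winding number, while twice this loop is contractible (`exists_eq_zero_of_frame_odd`).

The complex built from `T` merely subdivides the pieces of `F`: no edge image enters the interior of
a triangle of `T`, so a triangle whose interior meets the image of a triangle of `K` lies in that
image (`IsImageTriangulation.subset_image`, `neighborComplex_eq_closure`). -/

namespace DiscreteHopf

open Topology

/-! ### Factorizations into an even and an odd function, and their homotopy invariance -/

section Factorization

variable {Y : Type*} [TopologicalSpace Y]

/-- `G` is the product of an even function with zero set `Z₁` and an odd function with zero
set `Z₂`, evenness and oddness being meant with respect to `σ`. -/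
def HasParityFactorization (σ : Y → Y) (G : Y → ℂ) (Z₁ Z₂ : Set Y) : Prop :=
  ∃ E H : Y → ℂ, Continuous E ∧ Continuous H ∧ (∀ y, E y * H y = G y) ∧
    (∀ y, E y = 0 ↔ y ∈ Z₁) ∧ (∀ y, H y = 0 ↔ y ∈ Z₂) ∧
    (∀ y, E (σ y) = E y) ∧ ∀ y, H (σ y) = -H y

/-- A factorization of `G` is carried over to a nearby function `G'`, given a cutoff function `φ`
that separates the two parts of the zero sets. -/
lemma HasParityFactorization.of_near {σ : Y → Y} {G G' : Y → ℂ} {Z₁ Z₂ Z₁' Z₂' : Set Y}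
    {φ : Y → ℝ} (h : HasParityFactorization σ G Z₁ Z₂) (hG' : Continuous G')
    (hodd : ∀ y, G' (σ y) = -G' y) (hzero : ∀ y, G' y = 0 ↔ y ∈ Z₁' ∨ y ∈ Z₂')
    (hφ : Continuous φ) (hφσ : ∀ y, φ (σ y) = φ y)
    (h₁ : ∀ y ∈ Z₁, φ y = 1) (h₁' : ∀ y ∈ Z₁', ∀ᶠ x in 𝓝 y, φ x = 1)
    (h₂ : ∀ y ∈ Z₂, ∀ᶠ x in 𝓝 y, φ x = 0) (h₂' : ∀ y ∈ Z₂', φ y = 0)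
    (hnear : ∀ y, φ y ≠ 0 → φ y ≠ 1 → 0 ≤ φ y ∧ φ y ≤ 1 ∧ ‖G' y - G y‖ < ‖G y‖) :
    HasParityFactorization σ G' Z₁' Z₂' := by
  obtain ⟨E, H, hE, hH, hEH, hE0, hH0, hEσ, hHσ⟩ := h
  -- Where `φ = 1` the factor `H` is kept and `E` absorbs the change; where `φ = 0` the roles are
  -- exchanged. Division by `H` is harmless, since `φ` vanishes near the zeros of `H`.
  set E' : Y → ℂ := fun y => (1 - φ y) * E y + φ y * G' y / H y with hE'
  have hHne : ∀ y, φ y ≠ 0 → H y ≠ 0 := fun y hy h0 =>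
    hy ((h₂ y ((hH0 y).1 h0)).self_of_nhds)
  have hE'one : ∀ y, φ y = 1 → E' y = G' y / H y := by
    intro y hy; simp [hE', hy]
  have hE'ne : ∀ y, φ y ≠ 1 → E' y ≠ 0 := by
    intro y hy
    have hEne : E y ≠ 0 := fun h0 => hy (h₁ y ((hE0 y).1 h0))
    by_cases hy0 : φ y = 0
    · simpa [hE', hy0] using hEne
    · obtain ⟨hφ0, hφ1, hlt⟩ := hnear y hy0 hy
      have hHy := hHne y hy0
      have hGy : G y ≠ 0 := by rw [← hEH]; exact mul_ne_zero hEne hHy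
      -- In the transition zone `E' * H` differs from `G` by less than `‖G‖`, so no new zero arises.
      have key : E' y * H y = G y + φ y * (G' y - G y) := by
        rw [← hEH]; simp only [hE']; field_simp; ring
      intro h0
      rw [h0, zero_mul] at key
      have h3 : G y = -(φ y * (G' y - G y)) := by linear_combination -key
      have h4 : ‖G y‖ = φ y * ‖G' y - G y‖ := by
        conv_lhs => rw [h3]
        rw [norm_neg, norm_mul, Complex.norm_real, Real.norm_of_nonneg hφ0]
      have h5 : φ y * ‖G' y - G y‖ ≤ 1 * ‖G' y - G y‖ := by gcongr
      linarith
  have hE'zero : ∀ y, E' y = 0 ↔ y ∈ Z₁' := by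
    intro y
    constructor
    · intro h0
      have hy : φ y = 1 := by by_contra hy; exact hE'ne y hy h0
      rw [hE'one y hy, div_eq_zero_iff] at h0
      rcases h0 with h0 | h0
      · rcases (hzero y).1 h0 with h | h
        · exact h
        · have := h₂' y h; simp [hy] at this
      · exact absurd h0 (hHne y (by simp [hy]))
    · intro hy
      rw [hE'one y (h₁' y hy).self_of_nhds, (hzero y).2 (Or.inl hy), zero_div]
  have hE'c : Continuous E' := by
    rw [continuous_iff_continuousAt]
    intro y
    by_cases hy : H y = 0
    · have hev := h₂ y ((hH0 y).1 hy)
      have : E' =ᶠ[𝓝 y] E := by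
        filter_upwards [hev] with x hx; simp [hE', hx]
      exact hE.continuousAt.congr this.symm
    · simp only [hE']
      have c1 : Continuous fun y => (φ y : ℂ) := Complex.continuous_ofReal.comp hφ
      exact ((continuousAt_const.sub c1.continuousAt).mul hE.continuousAt).add
        ((c1.continuousAt.mul hG'.continuousAt).div hH.continuousAt hy)
  classical
  -- Away from the zeros of `E'` both branches equal `G' / E'`; near such a zero `φ = 1`, so only
  -- the first branch occurs. This gives continuity.
  set H' : Y → ℂ := fun y => if φ y = 1 then H y else G' y / E' y with hH'
  have hdiv : ∀ y, E' y ≠ 0 → H' y = G' y / E' y := by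
    intro y hy
    by_cases h1 : φ y = 1
    · have hHy := hHne y (by simp [h1])
      have e := hE'one y h1
      simp only [hH', h1, if_true]
      rw [eq_div_iff hy, e, mul_div_cancel₀ _ hHy]
    · simp [hH', h1]
  have hE'σ : ∀ y, E' (σ y) = E' y := by
    intro y
    simp only [hE', hφσ, hEσ, hodd, hHσ]
    rw [mul_neg, neg_div_neg_eq]
  refine ⟨E', H', hE'c, ?_, ?_, hE'zero, ?_, ?_, ?_⟩
  · rw [continuous_iff_continuousAt]
    intro y
    by_cases hy : E' y = 0
    · have : H' =ᶠ[𝓝 y] H := by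
        filter_upwards [h₁' y ((hE'zero y).1 hy)] with x hx; simp [hH', hx]
      exact hH.continuousAt.congr this.symm
    · have : H' =ᶠ[𝓝 y] fun x => G' x / E' x := by
        filter_upwards [hE'c.continuousAt.eventually_ne hy] with x hx using hdiv x hx
      exact (hG'.continuousAt.div hE'c.continuousAt hy).congr this.symm
  · intro y
    by_cases hy : E' y = 0
    · rw [hy, zero_mul, eq_comm, hzero]; exact Or.inl ((hE'zero y).1 hy)
    · rw [hdiv y hy, mul_div_cancel₀ _ hy]
  · intro y
    by_cases h1 : φ y = 1
    · have hHy := hHne y (by simp [h1])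
      simp only [hH', h1, if_true, hHy, false_iff]
      intro hy; have := h₂' y hy; simp [h1] at this
    · have h2 := hE'ne y h1
      simp only [hH', h1, if_false, div_eq_zero_iff, h2, or_false, hzero]
      refine ⟨fun h => h.resolve_left fun hy => h1 (h₁' y hy).self_of_nhds, Or.inr⟩
  · exact hE'σ
  · intro y
    simp only [hH', hφσ, hHσ, hodd, hE'σ]
    split_ifs <;> ring

variable [CompactSpace Y] [NormalSpace Y]

/-- A parity factorization extends along a homotopy of odd functions whose zero set is the union
of two disjoint closed invariant sets. -/
lemma HasParityFactorization.of_homotopy {I : Type*} [TopologicalSpace I] [PreconnectedSpace I]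
    {σ : Y → Y} (hσ : Continuous σ) (hσσ : ∀ y, σ (σ y) = y)
    {G : I × Y → ℂ} (hG : Continuous G) (hodd : ∀ τ y, G (τ, σ y) = -G (τ, y))
    {Z₁ Z₂ : Set (I × Y)} (hZ₁ : IsClosed Z₁) (hZ₂ : IsClosed Z₂) (hdisj : Disjoint Z₁ Z₂)
    (hZ₁σ : ∀ τ y, (τ, y) ∈ Z₁ → (τ, σ y) ∈ Z₁) (hZ₂σ : ∀ τ y, (τ, y) ∈ Z₂ → (τ, σ y) ∈ Z₂)
    (hzero : ∀ x, G x = 0 ↔ x ∈ Z₁ ∨ x ∈ Z₂) (τ₀ τ₁ : I)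
    (h : HasParityFactorization σ (fun y => G (τ₀, y)) {y | (τ₀, y) ∈ Z₁} {y | (τ₀, y) ∈ Z₂}) :
    HasParityFactorization σ (fun y => G (τ₁, y)) {y | (τ₁, y) ∈ Z₁} {y | (τ₁, y) ∈ Z₂} := by
  set P : I → Prop := fun τ =>
    HasParityFactorization σ (fun y => G (τ, y)) {y | (τ, y) ∈ Z₁} {y | (τ, y) ∈ Z₂} with hP
  -- The two implications make the set of good parameters closed and open, respectively.
  have hloc : ∀ τ : I, ∀ᶠ τ' in 𝓝 τ, (P τ' → P τ) ∧ (P τ → P τ') := by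
    intro τ
    obtain ⟨ψ, hψ0, hψ1, -⟩ := exists_continuous_zero_one_of_isClosed
      (s := {y | (τ, y) ∈ Z₂}) (t := {y | (τ, y) ∈ Z₁})
      (hZ₂.preimage (Continuous.prodMk_right τ)) (hZ₁.preimage (Continuous.prodMk_right τ))
      (Set.disjoint_left.2 fun y hy hy' => Set.disjoint_left.1 hdisj hy' hy)
    -- Averaging over `σ` makes the Urysohn function even.
    set χ : Y → ℝ := fun y => (ψ y + ψ (σ y)) / 2 with hχ
    have hχc : Continuous χ := by fun_prop
    have hχσ : ∀ y, χ (σ y) = χ y := by intro y; simp only [hχ, hσσ]; ring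
    have hχ0 : ∀ y, (τ, y) ∈ Z₂ → χ y = 0 := by
      intro y hy
      have a := hψ0 (show y ∈ {y | (τ, y) ∈ Z₂} from hy)
      have b := hψ0 (show σ y ∈ {y | (τ, y) ∈ Z₂} from hZ₂σ _ _ hy)
      simp only [hχ, a, b, Pi.zero_apply]; norm_num
    have hχ1 : ∀ y, (τ, y) ∈ Z₁ → χ y = 1 := by
      intro y hy
      have a := hψ1 (show y ∈ {y | (τ, y) ∈ Z₁} from hy)
      have b := hψ1 (show σ y ∈ {y | (τ, y) ∈ Z₁} from hZ₁σ _ _ hy)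
      simp only [hχ, a, b, Pi.one_apply]; norm_num
    -- The plateaus beyond 1/3 and 2/3 leave room for the zero sets at nearby parameters to move
    -- without meeting the transition zone.
    set φ : Y → ℝ := fun y => max 0 (min 1 (3 * χ y - 1)) with hφ
    have hφc : Continuous φ := by fun_prop
    have hφ01 : ∀ y, 0 ≤ φ y ∧ φ y ≤ 1 := fun y => ⟨le_max_left _ _, by simp [hφ]⟩
    have hφ1 : ∀ y, 2 / 3 < χ y → φ y = 1 := by
      intro y hy
      simp only [hφ]
      rw [min_eq_left (by linarith), max_eq_right (by norm_num)]
    have hφ0 : ∀ y, χ y < 1 / 3 → φ y = 0 := by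
      intro y hy
      simp only [hφ]
      rw [min_eq_right (by linarith), max_eq_left (by linarith)]
    have ev1 : ∀ᶠ τ' in 𝓝 τ, ∀ y ∈ (Set.univ : Set Y), (τ', y) ∈ Z₁ → 2 / 3 < χ y := by
      refine isCompact_univ.eventually_forall_of_forall_eventually fun y _ => ?_
      by_cases hy : (τ, y) ∈ Z₁
      · have : ∀ᶠ z : I × Y in 𝓝 (τ, y), 2 / 3 < χ z.2 :=
          (hχc.comp continuous_snd).continuousAt.eventually
            (lt_mem_nhds (by simp [hχ1 y hy]; norm_num))
        exact this.mono fun z hz _ => hz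
      · filter_upwards [hZ₁.isOpen_compl.mem_nhds hy] with z hz hz' using absurd hz' hz
    have ev2 : ∀ᶠ τ' in 𝓝 τ, ∀ y ∈ (Set.univ : Set Y), (τ', y) ∈ Z₂ → χ y < 1 / 3 := by
      refine isCompact_univ.eventually_forall_of_forall_eventually fun y _ => ?_
      by_cases hy : (τ, y) ∈ Z₂
      · have : ∀ᶠ z : I × Y in 𝓝 (τ, y), χ z.2 < 1 / 3 :=
          (hχc.comp continuous_snd).continuousAt.eventually
            (gt_mem_nhds (by simp [hχ0 y hy]))
        exact this.mono fun z hz _ => hz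
      · filter_upwards [hZ₂.isOpen_compl.mem_nhds hy] with z hz hz' using absurd hz' hz
    -- Both inequalities are needed because the factorization is transferred in both directions.
    have ev3 : ∀ᶠ τ' in 𝓝 τ, ∀ y ∈ χ ⁻¹' Set.Icc (1 / 3) (2 / 3),
        ‖G (τ', y) - G (τ, y)‖ < ‖G (τ, y)‖ ∧ ‖G (τ, y) - G (τ', y)‖ < ‖G (τ', y)‖ := by
      refine IsCompact.eventually_forall_of_forall_eventually
        (isClosed_Icc.preimage hχc).isCompact fun y hy => ?_
      have hne : G (τ, y) ≠ 0 := by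
        rw [Ne, hzero]
        rintro (h | h)
        · have := hχ1 y h; rw [Set.mem_preimage, this] at hy; norm_num at hy
        · have := hχ0 y h; rw [Set.mem_preimage, this] at hy; norm_num at hy
      have c1 : Continuous fun z : I × Y => ‖G (z.1, z.2) - G (τ, z.2)‖ := by fun_prop
      have c2 : Continuous fun z : I × Y => ‖G (τ, z.2)‖ := by fun_prop
      have c3 : Continuous fun z : I × Y => ‖G (τ, z.2) - G (z.1, z.2)‖ := by fun_prop
      have c4 : Continuous fun z : I × Y => ‖G (z.1, z.2)‖ := by fun_prop
      refine (c1.continuousAt.eventually_lt c2.continuousAt (by simpa using hne)).and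
        (c3.continuousAt.eventually_lt c4.continuousAt (by simpa using hne))
    have hmid : ∀ y, φ y ≠ 0 → φ y ≠ 1 → y ∈ χ ⁻¹' Set.Icc (1 / 3) (2 / 3) := fun y h0 h1 =>
      ⟨not_lt.1 fun h => h0 (hφ0 y h), not_lt.1 fun h => h1 (hφ1 y h)⟩
    have ev1' := ev1.self_of_nhds
    have ev2' := ev2.self_of_nhds
    have open1 : ∀ y, 2 / 3 < χ y → ∀ᶠ x in 𝓝 y, φ x = 1 := fun y hy =>
      (hχc.continuousAt.eventually (lt_mem_nhds hy)).mono fun x hx => hφ1 x hx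
    have open0 : ∀ y, χ y < 1 / 3 → ∀ᶠ x in 𝓝 y, φ x = 0 := fun y hy =>
      (hχc.continuousAt.eventually (gt_mem_nhds hy)).mono fun x hx => hφ0 x hx
    filter_upwards [ev1, ev2, ev3] with τ' e1 e2 e3
    constructor
    · intro h
      exact h.of_near (φ := φ) (by fun_prop) (hodd τ) (fun y => hzero (τ, y)) hφc
        (fun y => by simp only [hφ, hχσ])
        (fun y hy => hφ1 y (e1 y trivial hy)) (fun y hy => open1 y (ev1' y trivial hy))
        (fun y hy => open0 y (e2 y trivial hy)) (fun y hy => hφ0 y (ev2' y trivial hy))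
        (fun y h0 h1 => ⟨(hφ01 y).1, (hφ01 y).2, (e3 y (hmid y h0 h1)).2⟩)
    · intro h
      exact h.of_near (φ := φ) (by fun_prop) (hodd τ') (fun y => hzero (τ', y)) hφc
        (fun y => by simp only [hφ, hχσ])
        (fun y hy => hφ1 y (ev1' y trivial hy)) (fun y hy => open1 y (e1 y trivial hy))
        (fun y hy => open0 y (ev2' y trivial hy)) (fun y hy => hφ0 y (e2 y trivial hy))
        (fun y h0 h1 => ⟨(hφ01 y).1, (hφ01 y).2, (e3 y (hmid y h0 h1)).1⟩)
  have hclopen : IsClopen {τ | P τ} := by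
    refine ⟨⟨?_⟩, ?_⟩
    · rw [isOpen_iff_mem_nhds]
      intro τ hτ
      filter_upwards [hloc τ] with τ' hτ' h using hτ (hτ'.1 h)
    · rw [isOpen_iff_mem_nhds]
      intro τ hτ
      filter_upwards [hloc τ] with τ' hτ' using hτ'.2 hτ
  have : τ₁ ∈ {τ | P τ} := by
    rw [hclopen.eq_univ ⟨τ₀, h⟩]; trivial
  exact this

end Factorization

/-! ### The fundamental group of the space of frames -/

section Frames

/-- The pairs of orthogonal unit vectors in Euclidean 3-space. -/
def frames : Set (E3 × E3) := {x | ‖x.1‖ = 1 ∧ ‖x.2‖ = 1 ∧ inner ℝ x.1 x.2 = 0}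

lemma isCompact_frames : IsCompact frames := by
  have hsub : frames ⊆ Metric.sphere 0 1 ×ˢ Metric.sphere 0 1 := fun x hx =>
    ⟨by simpa using hx.1, by simpa using hx.2.1⟩
  refine ((isCompact_sphere _ _).prod (isCompact_sphere _ _)).of_isClosed_subset ?_ hsub
  have h1 : IsClosed {x : E3 × E3 | ‖x.1‖ = 1} :=
    isClosed_eq (by fun_prop) continuous_const
  have h2 : IsClosed {x : E3 × E3 | ‖x.2‖ = 1} :=
    isClosed_eq (by fun_prop) continuous_const
  have h3 : IsClosed {x : E3 × E3 | inner ℝ x.1 x.2 = 0} :=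
    isClosed_eq (by fun_prop) continuous_const
  exact h1.inter (h2.inter h3)

instance : CompactSpace frames := isCompact_iff_compactSpace.1 isCompact_frames

/-- Reversal of the second vector of a frame. -/
def frameFlip (x : frames) : frames :=
  ⟨(x.1.1, -x.1.2), x.2.1, by simpa using x.2.2.1, by simpa using x.2.2.2⟩

lemma continuous_frameFlip : Continuous frameFlip :=
  Continuous.subtype_mk (by fun_prop) _

lemma frameFlip_frameFlip (x : frames) : frameFlip (frameFlip x) = x := by
  ext <;> simp [frameFlip]

/-- The first two columns of the rotation matrix of the quaternion `a + bi + cj`. -/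
lemma quaternion_mem_frames {a b c : ℝ} (h : a ^ 2 + b ^ 2 + c ^ 2 = 1) :
    ((!₂[a ^ 2 + b ^ 2 - c ^ 2, 2 * b * c, -2 * a * c],
      !₂[2 * b * c, a ^ 2 - b ^ 2 + c ^ 2, 2 * a * b]) : E3 × E3) ∈ frames := by
  refine ⟨?_, ?_, ?_⟩
  · rw [← sq_eq_sq₀ (norm_nonneg _) zero_le_one, EuclideanSpace.norm_sq_eq]
    simp only [Fin.sum_univ_three, Real.norm_eq_abs, sq_abs]
    simp
    linear_combination (a ^ 2 + b ^ 2 + c ^ 2 + 1) * h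
  · rw [← sq_eq_sq₀ (norm_nonneg _) zero_le_one, EuclideanSpace.norm_sq_eq]
    simp only [Fin.sum_univ_three, Real.norm_eq_abs, sq_abs]
    simp
    linear_combination (a ^ 2 + b ^ 2 + c ^ 2 + 1) * h
  · simp [PiLp.inner_apply, Fin.sum_univ_three]
    ring

/-- A nonvanishing continuous function on the plane is an exponential. -/
lemma exists_continuous_log {g : ℂ → ℂ} (hg : Continuous g) (h0 : ∀ z, g z ≠ 0) :
    ∃ l : ℂ → ℂ, Continuous l ∧ ∀ z, Complex.exp (l z) = g z := by
  obtain ⟨F, ⟨-, hF⟩, -⟩ := Complex.isCoveringMap_exp.existsUnique_continuousMap_lifts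
    (⟨fun z => ⟨g z, h0 z⟩, hg.subtype_mk _⟩ : C(ℂ, {z : ℂ // z ≠ 0})) 0 (Complex.log (g 0))
    (by ext; simp [Complex.exp_log (h0 0)])
  exact ⟨F, F.continuous, fun z => congrArg Subtype.val (congrFun hF z)⟩

/-- A nonvanishing function on the plane cannot change its sign under the rotation of the unit
circle by a quarter turn. -/
lemma not_forall_quarter_turn_neg {g : ℂ → ℂ} (hg : Continuous g) (h0 : ∀ z, g z ≠ 0) :
    ¬ ∀ z : ℂ, ‖z‖ = 1 → g (Complex.I * z) = -g z := by
  intro hodd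
  obtain ⟨l, hl, hexp⟩ := exists_continuous_log hg h0
  have hpi : (Real.pi : ℂ) * Complex.I ≠ 0 := by
    simp [Real.pi_ne_zero]
  -- A quarter turn changes the logarithm by an odd multiple of `πi`, the same all around the
  -- circle. Four quarter turns return to the start, so four times an odd number would be zero.
  have hn : ∀ z : ℂ, ‖z‖ = 1 → ∃ n : ℤ, (l (Complex.I * z) - l z) / (Real.pi * Complex.I)
      = 2 * n + 1 := by
    intro z hz
    have h1 : Complex.exp (l (Complex.I * z)) = Complex.exp (l z + Real.pi * Complex.I) := by
      rw [Complex.exp_add, Complex.exp_pi_mul_I, hexp, hexp, hodd z hz]; ring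
    obtain ⟨n, hn⟩ := Complex.exp_eq_exp_iff_exists_int.1 h1
    refine ⟨n, ?_⟩
    rw [div_eq_iff hpi, hn]; ring
  choose! n hn using hn
  set q : ℂ → ℝ := fun z => ((l (Complex.I * z) - l z) / (Real.pi * Complex.I)).re with hq
  have hqc : Continuous q := by
    simp only [hq]; fun_prop
  have hqn : ∀ z : ℂ, ‖z‖ = 1 → q z = 2 * n z + 1 := by
    intro z hz; simp [hq, hn z hz]
  have hconn : IsPreconnected (Metric.sphere (0 : ℂ) 1) :=
    (isConnected_sphere (by simp) 0 zero_le_one).isPreconnected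
  have hconst : ∀ z : ℂ, ‖z‖ = 1 → n z = n 1 := by
    intro z hz
    by_contra hne
    have him := hconn.image q hqc.continuousOn
    -- If `n` increased, the intermediate value theorem would give `q` an even integer value on the
    -- circle, where it takes only odd ones.
    have key : ∀ {x y : ℂ}, ‖x‖ = 1 → ‖y‖ = 1 → n x < n y → False := by
      intro x y hx hy hlt
      have hxy := him.ordConnected.out ⟨x, by simpa using hx, rfl⟩ ⟨y, by simpa using hy, rfl⟩
      have hlt' : (n x : ℝ) + 1 ≤ n y := by exact_mod_cast hlt
      obtain ⟨w, hw, hwq⟩ := hxy (show (2 * n x + 2 : ℝ) ∈ Set.Icc (q x) (q y) by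
        rw [hqn x hx, hqn y hy]; constructor <;> linarith)
      rw [hqn w (by simpa using hw)] at hwq
      have : 2 * n w + 1 = 2 * n x + 2 := by exact_mod_cast hwq
      omega
    rcases lt_or_gt_of_ne hne with h | h
    · exact key hz (by simp) h
    · exact key (by simp) hz h
  have hstep : ∀ z : ℂ, ‖z‖ = 1 →
      l (Complex.I * z) = l z + (2 * n 1 + 1) * (Real.pi * Complex.I) := by
    intro z hz
    have := hn z hz
    rw [div_eq_iff hpi, hconst z hz] at this
    linear_combination this
  have e1 := hstep 1 (by simp)
  have e2 := hstep (Complex.I * 1) (by simp)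
  have e3 := hstep (Complex.I * (Complex.I * 1)) (by simp)
  have e4 := hstep (Complex.I * (Complex.I * (Complex.I * 1))) (by simp)
  have e : Complex.I * (Complex.I * (Complex.I * (Complex.I * 1))) = 1 := by
    linear_combination (Complex.I ^ 2 - 1) * Complex.I_sq
  rw [e] at e4
  have h5 : (4 : ℂ) * (2 * n 1 + 1) * (Real.pi * Complex.I) = 0 := by
    linear_combination -e4 - e3 - e2 - e1
  have h6 : (4 : ℂ) * (2 * n 1 + 1) = 0 := (mul_eq_zero.1 h5).resolve_right hpi
  have h7 : 4 * (2 * n 1 + 1) = 0 := by exact_mod_cast h6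
  omega

/-- There is no odd nonvanishing function on the space of frames: the loop of frames with a fixed
first vector has order two. -/
lemma exists_eq_zero_of_frame_odd {H : frames → ℂ} (hH : Continuous H)
    (hodd : ∀ y, H (frameFlip y) = -H y) : ∃ y, H y = 0 := by
  by_contra! h0
  -- The plane is retracted to the unit disc, and the disc is lifted to a hemisphere of unit
  -- quaternions. On the unit circle `c = 0`: the first vector of the frame is constant and the
  -- second is `z ^ 2` in the orthogonal plane. So the loop is run through twice, and a quarter turn
  -- of `z` is the flip.
  set r : ℂ → ℂ := fun z => ((max 1 ‖z‖)⁻¹ : ℝ) • z with hr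
  have hmax : ∀ z : ℂ, 0 < max 1 ‖z‖ := fun z => lt_max_of_lt_left one_pos
  have hrc : Continuous r := by
    simp only [hr]
    exact ((continuous_const.max continuous_norm).inv₀ fun z => (hmax z).ne').smul continuous_id
  have hr1 : ∀ z, ‖r z‖ ≤ 1 := by
    intro z
    simp only [hr, norm_smul, norm_inv, Real.norm_eq_abs, abs_of_pos (hmax z)]
    rw [inv_mul_le_iff₀ (hmax z), mul_one]; exact le_max_right _ _
  set c : ℂ → ℝ := fun z => √(1 - ‖r z‖ ^ 2) with hc
  have hcc : Continuous c := by simp only [hc]; fun_prop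
  have hsum : ∀ z, (r z).re ^ 2 + (r z).im ^ 2 + c z ^ 2 = 1 := by
    intro z
    have h1 : 0 ≤ 1 - ‖r z‖ ^ 2 := by nlinarith [hr1 z, norm_nonneg (r z)]
    simp only [hc]
    rw [Real.sq_sqrt h1, Complex.sq_norm, Complex.normSq_apply]; ring
  set Φ : ℂ → frames := fun z => ⟨_, quaternion_mem_frames (hsum z)⟩ with hΦ
  have hΦc : Continuous Φ := by
    refine Continuous.subtype_mk (Continuous.prodMk ?_ ?_) _
    · refine (PiLp.continuous_toLp 2 _).comp (continuous_pi fun i => ?_)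
      fin_cases i <;> simp <;> fun_prop
    · refine (PiLp.continuous_toLp 2 _).comp (continuous_pi fun i => ?_)
      fin_cases i <;> simp <;> fun_prop
  refine not_forall_quarter_turn_neg (hH.comp hΦc) (fun z => h0 _) fun z hz => ?_
  have hrz : ∀ w : ℂ, ‖w‖ = 1 → r w = w := by
    intro w hw; simp [hr, hw]
  have hcz : ∀ w : ℂ, ‖w‖ = 1 → c w = 0 := by
    intro w hw; simp [hc, hrz w hw, hw]
  have hIz : ‖Complex.I * z‖ = 1 := by simpa using hz
  have hflip : Φ (Complex.I * z) = frameFlip (Φ z) := by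
    apply Subtype.ext
    simp only [hΦ, frameFlip, hrz _ hz, hrz _ hIz, hcz _ hz, hcz _ hIz]
    refine Prod.ext ?_ ?_
    · ext i; fin_cases i <;> simp; ring
    · ext i; fin_cases i <;> simp; ring
  simp only [Function.comp_apply, hflip, hodd]

end Frames

/-! ### From separated coincidence pairs to a contradiction -/

section Radial

/-- The radial function of a convex body with respect to an interior point `p`. -/
lemma exists_radial_function {B : Set E3} (hconv : Convex ℝ B) (hcomp : IsCompact B) {p : E3}
    (hp : p ∈ interior B) : ∃ g : E3 → ℝ, Continuous g ∧ (∀ w, w ≠ 0 → 0 < g w) ∧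
      (∀ w, w ≠ 0 → p + (g w)⁻¹ • w ∈ frontier B) ∧ ∀ x ∈ frontier B, g (x - p) = 1 := by
  set C : Set E3 := (Homeomorph.addLeft p) ⁻¹' B with hC
  have hCconv : Convex ℝ C := by
    have := hconv.translate_preimage_right p
    exact this
  have hCcomp : IsCompact C := (Homeomorph.addLeft p).isCompact_preimage.2 hcomp
  have hC0 : C ∈ 𝓝 (0 : E3) :=
    (Homeomorph.addLeft p).continuous.continuousAt.preimage_mem_nhds
      (by simpa using mem_interior_iff_mem_nhds.1 hp)
  have hfr : frontier C = (Homeomorph.addLeft p) ⁻¹' frontier B :=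
    ((Homeomorph.addLeft p).preimage_frontier B).symm
  have hpos : ∀ w : E3, w ≠ 0 → 0 < gauge C w := fun w hw =>
    (gauge_pos (absorbent_nhds_zero hC0)
      (NormedSpace.isVonNBounded_of_isBounded _ hCcomp.isBounded)).2 hw
  refine ⟨gauge C, continuous_gauge hCconv hC0, hpos, fun w hw => ?_, fun x hx => ?_⟩
  · have : (gauge C w)⁻¹ • w ∈ frontier C := by
      rw [← gauge_eq_one_iff_mem_frontier hCconv hC0,
        gauge_smul_of_nonneg (inv_nonneg.2 (hpos w hw).le), smul_eq_mul,
        inv_mul_cancel₀ (hpos w hw).ne']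
    rw [hfr] at this
    simpa using this
  · rw [gauge_eq_one_iff_mem_frontier hCconv hC0, hfr]
    simpa using hx

/-- Coincidence pairs of a map from the boundary of a convex body to the plane cannot be separated
into two closed symmetric sets, one of which misses the diagonal, while the other one contains no
antipodal pairs. -/
theorem false_of_separated_neighbors {B : Set E3} (hconv : Convex ℝ B) (hcomp : IsCompact B)
    {p : E3} (hp : p ∈ interior B) {f : E3 → E2} (hf : ContinuousOn f (frontier B))
    {F₁ F₂ : Set (E3 × E3)} (hF₁ : IsClosed F₁) (hF₂ : IsClosed F₂) (hdisj : Disjoint F₁ F₂)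
    (hs₁ : ∀ x ∈ F₁, x.swap ∈ F₁) (hs₂ : ∀ x ∈ F₂, x.swap ∈ F₂)
    (hfF₁ : ∀ x ∈ F₁, f x.1 = f x.2) (hfF₂ : ∀ x ∈ F₂, f x.1 = f x.2)
    (hcover : ∀ x ∈ distinctNeighbors (frontier B) f, x ∈ F₁ ∨ x ∈ F₂)
    (hdiag : ∀ c, (c, c) ∉ F₁) (hanti : ∀ a b, Antipodal B p a b → (a, b) ∉ F₂) : False := by
  obtain ⟨g, hg, hgpos, hgfr, -⟩ := exists_radial_function hconv hcomp hp
  -- The path from the first vector to the second has inner product `θ` with the second, so it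
  -- avoids the origin even for `θ` outside `[0, 1]`.
  set w : ℝ × frames → E3 := fun x => (1 - x.1) • x.2.1.1 + x.1 • x.2.1.2 with hw
  have hwc : Continuous w := by simp only [hw]; fun_prop
  have hwinner : ∀ x, inner ℝ (w x) x.2.1.2 = x.1 := by
    rintro ⟨θ, ⟨⟨m, v⟩, h1, h2, h3⟩⟩
    simp only at h1 h2 h3
    simp [hw, inner_add_left, inner_smul_left, h3, h2]
  have hw0 : ∀ x, w x ≠ 0 := by
    intro x hx
    have h1 := hwinner x
    rw [hx, inner_zero_left] at h1
    have h2 : w x = x.2.1.1 := by simp [hw, ← h1]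
    have h3 := x.2.2.1
    rw [← h2, hx, norm_zero] at h3
    exact zero_ne_one h3
  set β : ℝ × frames → E3 := fun x => p + (g (w x))⁻¹ • w x with hβ
  have hβc : Continuous β := by
    simp only [hβ]
    exact continuous_const.add
      (((hg.comp hwc).inv₀ fun x => (hgpos _ (hw0 x)).ne').smul hwc)
  have hβfr : ∀ x, β x ∈ frontier B := fun x => hgfr _ (hw0 x)
  set Ψ : ℝ × frames → E3 × E3 := fun x => (β (x.1, frameFlip x.2), β x) with hΨ
  have hflipc := continuous_frameFlip
  have hΨc : Continuous Ψ := by simp only [hΨ]; fun_prop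
  have hΨswap : ∀ θ y, Ψ (θ, frameFlip y) = (Ψ (θ, y)).swap := by
    intro θ y; simp [hΨ, frameFlip_frameFlip]
  -- Relative to `p`, the two points have inner products of opposite signs with the second vector of
  -- the frame.
  have hΨne : ∀ x, x.1 ≠ 0 → (Ψ x).1 ≠ (Ψ x).2 := by
    intro x hx h
    have h1 : (g (w (x.1, frameFlip x.2)))⁻¹ • w (x.1, frameFlip x.2) = (g (w x))⁻¹ • w x := by
      simpa [hΨ, hβ] using h
    have h2 := congrArg (fun u => inner ℝ u x.2.1.2) h1
    have h3 : inner ℝ (w (x.1, frameFlip x.2)) x.2.1.2 = -x.1 := by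
      have h4 : inner ℝ (w (x.1, frameFlip x.2)) (-x.2.1.2) = x.1 := hwinner (x.1, frameFlip x.2)
      rw [inner_neg_right] at h4
      linarith
    simp only [inner_smul_left, h3, hwinner x, conj_trivial] at h2
    have a1 := inv_pos.2 (hgpos _ (hw0 (x.1, frameFlip x.2)))
    have a2 := inv_pos.2 (hgpos _ (hw0 x))
    have : ((g (w (x.1, frameFlip x.2)))⁻¹ + (g (w x))⁻¹) * x.1 = 0 := by linarith
    rcases mul_eq_zero.1 this with h | h
    · linarith
    · exact hx h
  have hΨ0 : ∀ y, (Ψ (0, y)).1 = (Ψ (0, y)).2 := by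
    intro y; simp [hΨ, hβ, hw, frameFlip]
  have hΨ1 : ∀ y, Antipodal B p (Ψ (1, y)).1 (Ψ (1, y)).2 := by
    intro y
    refine ⟨hβfr _, hβfr _, ?_⟩
    have e1 : w (1, frameFlip y) = -w (1, y) := by simp [hw, frameFlip]
    have a1 := hgpos _ (hw0 (1, frameFlip y))
    have a2 := hgpos _ (hw0 (1, y))
    set r := g (w (1, frameFlip y))
    set s := g (w (1, y))
    -- The points are `p - r⁻¹ • u` and `p + s⁻¹ • u`, so weights proportional to `r` and `s` cancel
    -- the displacements.
    refine ⟨r / (r + s), s / (r + s), by positivity, by positivity, by field_simp, ?_⟩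
    have e2 : (Ψ (1, y)).1 = p - r⁻¹ • w (1, y) := by
      simp only [hΨ, hβ, r, e1, smul_neg, sub_eq_add_neg]
    have e3 : (Ψ (1, y)).2 = p + s⁻¹ • w (1, y) := rfl
    rw [e2, e3]
    generalize w (1, y) = u
    rw [smul_sub, smul_add, smul_smul, smul_smul]
    have e4 : r / (r + s) * r⁻¹ = s / (r + s) * s⁻¹ := by field_simp
    have e5 : r / (r + s) + s / (r + s) = 1 := by field_simp
    rw [e4, sub_add_add_cancel, ← add_smul, e5, one_smul]
  -- At `θ = 0` all pairs are diagonal, hence off the closed set `F₁`; compactness makes this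
  -- uniform for small `θ`.
  have hev : ∀ᶠ θ in 𝓝 (0 : ℝ), ∀ y ∈ (Set.univ : Set frames), Ψ (θ, y) ∉ F₁ := by
    refine isCompact_univ.eventually_forall_of_forall_eventually fun y _ => ?_
    refine hΨc.continuousAt.eventually (hF₁.isOpen_compl.mem_nhds fun h => ?_)
    have e : Ψ (0, y) = ((Ψ (0, y)).2, (Ψ (0, y)).2) := Prod.ext (hΨ0 y) rfl
    rw [e] at h
    exact hdiag _ h
  obtain ⟨ε, hε0, hε1, hε⟩ : ∃ ε : ℝ, 0 < ε ∧ ε < 1 ∧ ∀ y, Ψ (ε, y) ∉ F₁ := by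
    have h1 : ∀ᶠ θ in 𝓝[>] (0 : ℝ), θ < 1 :=
      nhdsWithin_le_nhds (gt_mem_nhds one_pos)
    have h0 : ∀ᶠ θ in 𝓝[>] (0 : ℝ), ∀ y ∈ (Set.univ : Set frames), Ψ (θ, y) ∉ F₁ :=
      nhdsWithin_le_nhds hev
    have h5 : ∀ᶠ θ in 𝓝[>] (0 : ℝ), 0 < θ := self_mem_nhdsWithin
    obtain ⟨ε, ⟨h2, h3⟩, h4⟩ := ((h0.and h1).and h5).exists
    exact ⟨ε, h4, h3, fun y => h2 y trivial⟩
  have : PreconnectedSpace (Set.Icc ε 1) := Subtype.preconnectedSpace isPreconnected_Icc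
  set ι : Set.Icc ε 1 × frames → ℝ × frames := fun x => (x.1.1, x.2) with hι
  have hιc : Continuous ι := by simp only [hι]; fun_prop
  set D : Set.Icc ε 1 × frames → E2 := fun x => f (Ψ (ι x)).1 - f (Ψ (ι x)).2 with hD
  have hDc : Continuous D := by
    refine Continuous.sub ?_ ?_
    · exact hf.comp_continuous (continuous_fst.comp (hΨc.comp hιc)) fun x => hβfr _
    · exact hf.comp_continuous (continuous_snd.comp (hΨc.comp hιc)) fun x => hβfr _
  set G : Set.Icc ε 1 × frames → ℂ := fun x => Complex.orthonormalBasisOneI.repr.symm (D x) with hG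
  have hGc : Continuous G :=
    Complex.orthonormalBasisOneI.repr.symm.continuous.comp hDc
  have hGodd : ∀ τ y, G (τ, frameFlip y) = -G (τ, y) := by
    intro τ y
    simp only [hG, ← map_neg, hD, hι, hΨswap]
    simp
  have hG0 : ∀ x, G x = 0 ↔ Ψ (ι x) ∈ F₁ ∨ Ψ (ι x) ∈ F₂ := by
    intro x
    have : G x = 0 ↔ f (Ψ (ι x)).1 = f (Ψ (ι x)).2 := by
      simp only [hG, hD, LinearIsometryEquiv.map_eq_zero_iff, sub_eq_zero]
    rw [this]
    refine ⟨fun h => hcover _ ⟨hβfr _, hβfr _, hΨne _ ?_, h⟩, fun h => h.elim (hfF₁ _) (hfF₂ _)⟩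
    exact (hε0.trans_le x.1.2.1).ne'
  have start : HasParityFactorization frameFlip
      (fun y => G (⟨ε, le_rfl, hε1.le⟩, y))
      {y | ((⟨ε, le_rfl, hε1.le⟩ : Set.Icc ε 1), y) ∈ (Ψ ∘ ι) ⁻¹' F₁}
      {y | ((⟨ε, le_rfl, hε1.le⟩ : Set.Icc ε 1), y) ∈ (Ψ ∘ ι) ⁻¹' F₂} := by
    refine ⟨fun _ => 1, _, continuous_const, by fun_prop, fun y => one_mul _, fun y => ?_,
      fun y => ?_, fun _ => rfl, fun y => hGodd _ y⟩
    · simpa [hι] using hε y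
    · rw [hG0]
      simp [hι, hε y]
  obtain ⟨E, H, -, hH, -, -, hH0, -, hHodd⟩ :=
    start.of_homotopy continuous_frameFlip frameFlip_frameFlip hGc hGodd
      (hF₁.preimage (hΨc.comp hιc)) (hF₂.preimage (hΨc.comp hιc)) (hdisj.preimage _)
      (fun τ y h => by simpa [hι, hΨswap] using hs₁ _ h)
      (fun τ y h => by simpa [hι, hΨswap] using hs₂ _ h) hG0 _ ⟨1, hε1.le, le_rfl⟩
  obtain ⟨y, hy⟩ := exists_eq_zero_of_frame_odd hH hHodd
  exact hanti _ _ (hΨ1 y) ((hH0 y).1 hy)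

end Radial

/-! ### Interiors and faces of simplices -/

section Simplices

/-- This is Baire's theorem for the complements. It discards thin sets: the cones over edges and
vertices at an interior point of `B`, and the frontiers of the simplices of `T`. -/
lemma interior_biUnion_eq_empty {X ι : Type*} [TopologicalSpace X] [BaireSpace X] {S : Set ι}
    (hS : S.Finite) {A : ι → Set X} (hclosed : ∀ i ∈ S, IsClosed (A i))
    (hint : ∀ i ∈ S, interior (A i) = ∅) : interior (⋃ i ∈ S, A i) = ∅ := by
  rw [interior_eq_empty_iff_dense_compl, Set.compl_iUnion₂]
  exact dense_biInter_of_isOpen (fun i hi => (hclosed i hi).isOpen_compl) hS.countable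
    fun i hi => interior_eq_empty_iff_dense_compl.1 (hint i hi)

variable {V : Type*} [NormedAddCommGroup V] [NormedSpace ℝ V]

lemma isClosed_convexHull_finset (s : Finset V) : IsClosed (convexHull ℝ (s : Set V)) :=
  (s.finite_toSet.isCompact_convexHull ℝ).isClosed

/-- The barycenter of a simplex lies in no proper face. -/
lemma subset_of_barycenter_mem_convexHull {K : Geometry.SimplicialComplex ℝ V} {e s : Finset V}
    (he : e ∈ K.faces) (hs : s ∈ K.faces)
    (h : ∑ u ∈ e, (e.card : ℝ)⁻¹ • u ∈ convexHull ℝ (s : Set V)) : e ⊆ s := by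
  classical
  have hpos : (0 : ℝ) < e.card := by
    exact_mod_cast (K.nonempty_of_mem_faces he).card_pos
  have hsum : ∑ _u ∈ e, (e.card : ℝ)⁻¹ = 1 := by
    rw [Finset.sum_const, nsmul_eq_mul, mul_inv_cancel₀ hpos.ne']
  have hmem : ∑ u ∈ e, (e.card : ℝ)⁻¹ • u ∈ convexHull ℝ (e : Set V) :=
    Finset.mem_convexHull'.2 ⟨fun _ => (e.card : ℝ)⁻¹, fun _ _ => by positivity, hsum, rfl⟩
  have hint := K.inter_subset_convexHull he hs ⟨hmem, h⟩
  rw [← Finset.coe_inter] at hint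
  obtain ⟨w, hw0, hw1, hw⟩ := Finset.mem_convexHull'.1 hint
  -- Extend the weights by zero to `e`. By uniqueness of barycentric coordinates, a vertex outside
  -- `s` would have both weight zero and weight `1 / e.card`.
  set w' : V → ℝ := fun v => if v ∈ e ∩ s then w v else 0 with hw'
  have hsub : e ∩ s ⊆ e := Finset.inter_subset_left
  have h1 : ∑ v ∈ e, w' v = 1 := by
    rw [← Finset.sum_subset hsub (fun v _ hv => by simp only [hw', hv, if_false]), ← hw1]
    exact Finset.sum_congr rfl fun v hv => by simp only [hw', hv, if_true]
  have h2 : ∑ v ∈ e, w' v • v = ∑ v ∈ e ∩ s, w v • v := by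
    rw [← Finset.sum_subset hsub (fun v _ hv => by simp only [hw', hv, if_false, zero_smul])]
    exact Finset.sum_congr rfl fun v hv => by simp only [hw', hv, if_true]
  have heq := (K.indep he).eq_of_sum_eq_sum_subtype (w₁ := w') (w₂ := fun _ => (e.card : ℝ)⁻¹)
    (by rw [h1, hsum]) (by rw [h2, hw])
  intro u hu
  by_contra hus
  have h3 := heq u hu
  simp only [hw', Finset.mem_inter, hus, and_false, if_false] at h3
  exact (inv_pos.2 hpos).ne h3

variable [FiniteDimensional ℝ V]

lemma interior_convexHull_eq_empty {s : Finset V} (hs : s.card ≤ Module.finrank ℝ V) :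
    interior (convexHull ℝ (s : Set V)) = ∅ := by
  classical
  by_contra hne
  have htop := interior_convexHull_nonempty_iff_affineSpan_eq_top.1
    (Set.nonempty_iff_ne_empty.2 hne)
  have hsne : s.Nonempty := by
    rw [Finset.nonempty_iff_ne_empty]; rintro rfl; simp at hne
  obtain ⟨n, hn⟩ : ∃ n, s.card = n + 1 := ⟨s.card - 1, by have := hsne.card_pos; omega⟩
  have h1 := finrank_vectorSpan_image_finset_le ℝ (id : V → V) s hn
  rw [Finset.image_id, ← direction_affineSpan, htop, AffineSubspace.direction_top,
    finrank_top] at h1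
  omega

lemma card_le_of_affineIndependent {s : Finset V} (hs : AffineIndependent ℝ ((↑) : s → V)) :
    s.card ≤ Module.finrank ℝ V + 1 := by
  have h1 := hs.card_le_finrank_succ
  have h2 := Submodule.finrank_le (vectorSpan ℝ (Set.range ((↑) : s → V)))
  rw [Fintype.card_coe] at h1
  omega

/-- A point of a full-dimensional simplex is interior if and only if its barycentric coordinates
are positive. -/
lemma sum_smul_mem_interior_convexHull_iff {t : Finset V}
    (ht : AffineIndependent ℝ ((↑) : t → V)) (hcard : t.card = Module.finrank ℝ V + 1)
    {w : V → ℝ} (hw : ∑ u ∈ t, w u = 1) :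
    ∑ u ∈ t, w u • u ∈ interior (convexHull ℝ (t : Set V)) ↔ ∀ u ∈ t, 0 < w u := by
  have htop : affineSpan ℝ (Set.range ((↑) : t → V)) = ⊤ := by
    rw [ht.affineSpan_eq_top_iff_card_eq_finrank_add_one, Fintype.card_coe, hcard]
  set b : AffineBasis t ℝ V := ⟨((↑) : t → V), ht, htop⟩ with hb
  have hbu : ∀ u : t, b u = u := fun u => rfl
  have hrange : Set.range b = (t : Set V) := by
    ext x; simp [hbu]
  have hw' : ∑ u : t, w u = 1 := by rw [Finset.sum_coe_sort]; exact hw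
  have hsum : ∑ u ∈ t, w u • u = Finset.univ.affineCombination ℝ b (fun u : t => w u) := by
    rw [Finset.affineCombination_eq_linear_combination _ _ _ hw']
    simp only [hbu]
    rw [Finset.sum_coe_sort t (fun u => w u • u)]
  rw [← hrange, b.interior_convexHull, hsum, Set.mem_ofPred_eq]
  constructor
  · intro h u hu
    have := h ⟨u, hu⟩
    rwa [b.coord_apply_combination_of_mem (Finset.mem_univ _) hw'] at this
  · intro h u
    rw [b.coord_apply_combination_of_mem (Finset.mem_univ _) hw']
    exact h u u.2

lemma interior_convexHull_nonempty {t : Finset V} (ht : AffineIndependent ℝ ((↑) : t → V))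
    (hcard : t.card = Module.finrank ℝ V + 1) : (interior (convexHull ℝ (t : Set V))).Nonempty := by
  rw [interior_convexHull_nonempty_iff_affineSpan_eq_top]
  have := ht.affineSpan_eq_top_iff_card_eq_finrank_add_one.2 (by rw [Fintype.card_coe, hcard])
  simpa using this

lemma disjoint_convexHull_interior_of_ssubset {c t : Finset V}
    (ht : AffineIndependent ℝ ((↑) : t → V)) (hcard : t.card = Module.finrank ℝ V + 1)
    (hct : c ⊂ t) : Disjoint (convexHull ℝ (c : Set V)) (interior (convexHull ℝ (t : Set V))) := by
  classical
  rw [Set.disjoint_left]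
  intro x hx hx'
  obtain ⟨w, hw0, hw1, rfl⟩ := Finset.mem_convexHull'.1 hx
  have hsub := hct.1
  obtain ⟨u, hut, huc⟩ := Finset.exists_of_ssubset hct
  set w' : V → ℝ := fun v => if v ∈ c then w v else 0 with hw'
  have h1 : ∑ v ∈ t, w' v = 1 := by
    rw [← Finset.sum_subset hsub (fun v _ hv => by simp [hw', hv]), ← hw1]
    exact Finset.sum_congr rfl fun v hv => by simp [hw', hv]
  have h2 : ∑ v ∈ c, w v • v = ∑ v ∈ t, w' v • v := by
    rw [← Finset.sum_subset hsub (fun v _ hv => by simp [hw', hv])]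
    exact Finset.sum_congr rfl fun v hv => by simp [hw', hv]
  rw [h2, sum_smul_mem_interior_convexHull_iff ht hcard h1] at hx'
  have := hx' u hut
  simp [hw', huc] at this

lemma exists_mem_convexHull_erase [DecidableEq V] {t : Finset V}
    (ht : AffineIndependent ℝ ((↑) : t → V)) (hcard : t.card = Module.finrank ℝ V + 1) {x : V}
    (hx : x ∈ convexHull ℝ (t : Set V)) (hx' : x ∉ interior (convexHull ℝ (t : Set V))) :
    ∃ u ∈ t, x ∈ convexHull ℝ ((t.erase u : Finset V) : Set V) := by
  obtain ⟨w, hw0, hw1, rfl⟩ := Finset.mem_convexHull'.1 hx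
  rw [sum_smul_mem_interior_convexHull_iff ht hcard hw1] at hx'
  push Not at hx'
  obtain ⟨u, hu, hwu⟩ := hx'
  have hwu0 : w u = 0 := le_antisymm hwu (hw0 u hu)
  refine ⟨u, hu, Finset.mem_convexHull'.2 ⟨w, fun y hy => hw0 y (Finset.mem_of_mem_erase hy),
    ?_, ?_⟩⟩
  · rw [Finset.sum_erase _ hwu0, hw1]
  · rw [Finset.sum_erase _ (by simp [hwu0])]

end Simplices

/-! ### Triangulations of the boundary are pure of dimension two -/

section Boundary

variable {B : Set E3} {K : Geometry.SimplicialComplex ℝ E3}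

lemma IsConvexPolyhedron.convex (hB : IsConvexPolyhedron B) : Convex ℝ B := by
  obtain ⟨⟨V, rfl⟩, -⟩ := hB
  exact convex_convexHull ℝ _

lemma IsConvexPolyhedron.isCompact (hB : IsConvexPolyhedron B) : IsCompact B := by
  obtain ⟨⟨V, rfl⟩, -⟩ := hB
  exact V.finite_toSet.isCompact_convexHull ℝ

/-- Four affinely independent points span a solid simplex, but the frontier of a closed set has no
interior. -/
lemma IsTriangulationOf.card_le_three (hB : IsConvexPolyhedron B)
    (hK : IsTriangulationOf K (frontier B)) {s : Finset E3} (hs : s ∈ K.faces) : s.card ≤ 3 := by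
  have h1 := card_le_of_affineIndependent (K.indep hs)
  simp only [finrank_euclideanSpace, Fintype.card_fin] at h1
  by_contra h2
  obtain ⟨x, hx⟩ := interior_convexHull_nonempty (K.indep hs)
    (by simp only [finrank_euclideanSpace, Fintype.card_fin]; omega)
  have h3 := interior_mono ((K.convexHull_subset_space hs).trans hK.2.subset) hx
  rw [interior_frontier hB.isCompact.isClosed] at h3
  exact h3

/-- The boundary of a convex polyhedron is covered by the triangles of a triangulation: the other
faces of the triangulation span finitely many cones of smaller dimension at an interior point. -/
lemma IsTriangulationOf.exists_triangle (hB : IsConvexPolyhedron B)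
    (hK : IsTriangulationOf K (frontier B)) {x : E3} (hx : x ∈ frontier B) :
    ∃ s ∈ K.faces, s.card = 3 ∧ x ∈ convexHull ℝ (s : Set E3) := by
  obtain ⟨p, hp⟩ := hB.2
  obtain ⟨g, hg, hgpos, hgfr, hg1⟩ := exists_radial_function hB.convex hB.isCompact hp
  by_contra! hno
  set S : Set (Finset E3) := {s ∈ K.faces | s.card = 3} with hS
  set C : Set E3 := ⋃ s ∈ S, convexHull ℝ (s : Set E3) with hC
  have hSfin : S.Finite := hK.1.subset fun s hs => hs.1
  have hCclosed : IsClosed C := hSfin.isClosed_biUnion fun s _ => isClosed_convexHull_finset s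
  have hxC : x ∉ C := by
    simp only [hC, Set.mem_iUnion, not_exists]
    exact fun s hs => hno s hs.1 hs.2
  -- Seen from `p`, a face with at most two vertices lies in a subspace of dimension at most two. If
  -- no triangle contained `x`, these subspaces would cover a neighborhood of `x - p`.
  set L : Finset E3 → Submodule ℝ E3 := fun s =>
    Submodule.span ℝ ((fun u => u - p) '' (s : Set E3)) with hL
  set S' : Set (Finset E3) := {s ∈ K.faces | s.card ≤ 2} with hS'
  have hempty : interior (⋃ s ∈ S', (L s : Set E3)) = ∅ := by
    refine interior_biUnion_eq_empty (hK.1.subset fun s hs => hs.1)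
      (fun s _ => (L s).closed_of_finiteDimensional) fun s hs => ?_
    by_contra hne
    have htop := (L s).eq_top_of_nonempty_interior' (Set.nonempty_iff_ne_empty.2 hne)
    classical
    have h1 : Module.finrank ℝ (L s) ≤ s.card := by
      change Module.finrank ℝ (Submodule.span ℝ ((fun u => u - p) '' (s : Set E3))) ≤ _
      rw [← Finset.coe_image]
      exact (finrank_span_finset_le_card _).trans Finset.card_image_le
    rw [htop, finrank_top] at h1
    simp only [finrank_euclideanSpace, Fintype.card_fin] at h1
    have := hs.2
    omega
  set ρ : E3 → E3 := fun w => p + (g w)⁻¹ • w with hρ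
  have hxp : x - p ≠ 0 := by
    intro h
    rw [sub_eq_zero] at h
    rw [h] at hx
    exact hx.2 hp
  have hρx : ρ (x - p) = x := by simp [hρ, hg1 x hx]
  have hρc : ContinuousAt ρ (x - p) :=
    continuousAt_const.add ((hg.continuousAt.inv₀ (hgpos _ hxp).ne').smul continuousAt_id)
  have hmem : x - p ∈ interior (⋃ s ∈ S', (L s : Set E3)) := by
    rw [mem_interior_iff_mem_nhds]
    have h1 : ∀ᶠ w in 𝓝 (x - p), ρ w ∈ Cᶜ :=
      hρc.eventually (by rw [hρx]; exact hCclosed.isOpen_compl.mem_nhds hxC)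
    have h2 : ∀ᶠ w in 𝓝 (x - p), w ≠ 0 := isOpen_ne.mem_nhds hxp
    filter_upwards [h1, h2] with w hw hw0
    have h3 : ρ w ∈ K.space := by rw [hK.2]; exact hgfr w hw0
    obtain ⟨s, hs, hws⟩ := Geometry.SimplicialComplex.mem_space_iff.1 h3
    have hs2 : s.card ≤ 2 := by
      have h4 := hK.card_le_three hB hs
      have h5 : s.card ≠ 3 := fun h => hw (Set.mem_biUnion (show s ∈ S from ⟨hs, h⟩) hws)
      omega
    refine Set.mem_biUnion (show s ∈ S' from ⟨hs, hs2⟩) ?_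
    have h6 : ρ w - p ∈ L s := by
      have hsub : convexHull ℝ (s : Set E3) ⊆ {y | y - p ∈ L s} := by
        refine convexHull_min (fun u hu => Submodule.subset_span ⟨u, hu, rfl⟩) ?_
        have : {y | y - p ∈ L s} = (fun y => y + -p) ⁻¹' (L s : Set E3) := by
          ext y; simp [sub_eq_add_neg]
        rw [this]
        exact (L s).convex.translate_preimage_left (-p)
      exact hsub hws
    have h7 : w = g w • (ρ w - p) := by
      simp [hρ, smul_smul, mul_inv_cancel₀ (hgpos w hw0).ne']
    rw [h7]
    exact (L s).smul_mem _ h6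
  rw [hempty] at hmem
  exact hmem

/-- Some triangle contains the barycenter of `e`, hence all of `e`. -/
lemma IsTriangulationOf.exists_triangle_superset (hB : IsConvexPolyhedron B)
    (hK : IsTriangulationOf K (frontier B)) {e : Finset E3} (he : e ∈ K.faces) :
    ∃ s ∈ K.faces, s.card = 3 ∧ e ⊆ s := by
  have hpos : (0 : ℝ) < e.card := by exact_mod_cast (K.nonempty_of_mem_faces he).card_pos
  have hmem : ∑ u ∈ e, (e.card : ℝ)⁻¹ • u ∈ convexHull ℝ (e : Set E3) :=
    Finset.mem_convexHull'.2 ⟨fun _ => (e.card : ℝ)⁻¹, fun _ _ => by positivity,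
      by rw [Finset.sum_const, nsmul_eq_mul, mul_inv_cancel₀ hpos.ne'], rfl⟩
  obtain ⟨s, hs, h3, hx⟩ := hK.exists_triangle hB
    (hK.2.subset (K.convexHull_subset_space he hmem))
  exact ⟨s, hs, h3, subset_of_barycenter_mem_convexHull he hs hx⟩

end Boundary

/-! ### Triangles under a map in general position -/

section AffineTriangles

variable {K : Geometry.SimplicialComplex ℝ E3} {f : E3 → E2} {s s' : Finset E3}

lemma mem_vertices_of_mem (hs : s ∈ K.faces) {u : E3} (hu : u ∈ s) : u ∈ K.vertices :=
  K.down_closed hs (Finset.singleton_subset_iff.2 hu) (Finset.singleton_nonempty u)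

lemma AffineMap.map_sum_smul {V W : Type*} [AddCommGroup V] [Module ℝ V] [AddCommGroup W]
    [Module ℝ W] (g : V →ᵃ[ℝ] W) {s : Finset V} {w : V → ℝ} (hw : ∑ u ∈ s, w u = 1) :
    g (∑ u ∈ s, w u • u) = ∑ u ∈ s, w u • g u := by
  have h1 := s.map_affineCombination id w hw g
  rwa [s.affineCombination_eq_linear_combination _ _ hw,
    s.affineCombination_eq_linear_combination _ _ hw] at h1

lemma IsGeneralPosition.affineIndependent (hfg : IsGeneralPosition K f) (hs : s ∈ K.faces)
    (h3 : s.card = 3) : AffineIndependent ℝ (fun u : s => f u) := by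
  classical
  obtain ⟨u, v, w, huv, huw, hvw, rfl⟩ := Finset.card_eq_three.1 h3
  have hncol := hfg u (mem_vertices_of_mem hs (by simp)) v (mem_vertices_of_mem hs (by simp)) w
    (mem_vertices_of_mem hs (by simp)) huv hvw huw
  by_contra h
  rw [← finrank_vectorSpan_le_iff_not_affineIndependent (n := 1) ℝ _ (by simpa using h3)] at h
  have hrange : Set.range (fun x : ({u, v, w} : Finset E3) => f x) = {f u, f v, f w} := by
    ext y; simp [eq_comm]
  rw [hrange] at h
  exact hncol (collinear_iff_finrank_le_one.2 h)

/-- Two vertices with equal images would be collinear in image with any third vertex; `s` only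
supplies this third vertex. -/
lemma IsGeneralPosition.map_ne (hfg : IsGeneralPosition K f) (hs : s ∈ K.faces)
    (h3 : s.card = 3) {u v : E3} (hu : u ∈ K.vertices) (hv : v ∈ K.vertices) (huv : u ≠ v) :
    f u ≠ f v := by
  classical
  intro h
  obtain ⟨w, hw, hwuv⟩ : ∃ w ∈ s, w ∉ ({u, v} : Finset E3) :=
    Finset.exists_mem_notMem_of_card_lt_card
      ((Finset.card_le_two).trans_lt (by rw [h3]; norm_num))
  simp only [Finset.mem_insert, Finset.mem_singleton, not_or] at hwuv
  refine hfg u hu v hv w (mem_vertices_of_mem hs hw) huv (Ne.symm hwuv.2) (Ne.symm hwuv.1) ?_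
  rw [h, Set.insert_eq_of_mem (Set.mem_insert _ _)]
  exact collinear_pair ℝ _ _

open Classical in
lemma IsGeneralPosition.affineIndependent_image (hfg : IsGeneralPosition K f) (hs : s ∈ K.faces)
    (h3 : s.card = 3) : AffineIndependent ℝ ((↑) : ↥(s.image f) → E2) ∧
      (s.image f).card = 3 := by
  have hind := hfg.affineIndependent hs h3
  constructor
  · have h1 := hind.range
    have hrange : Set.range (fun x : s => f x) = ((s.image f : Finset E2) : Set E2) := by
      ext y; simp
    rw [hrange] at h1
    exact h1
  · rw [Finset.card_image_of_injOn, h3]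
    intro u hu v hv huv
    exact congrArg Subtype.val
      (hind.injective (a₁ := (⟨u, hu⟩ : s)) (a₂ := (⟨v, hv⟩ : s)) huv)

lemma IsAffineOnTriangles.map_sum_smul (hfa : IsAffineOnTriangles K f) (hs : s ∈ K.faces)
    (h3 : s.card = 3) {σ : Finset E3} (hσ : σ ⊆ s) {w : E3 → ℝ} (hw0 : ∀ u ∈ σ, 0 ≤ w u)
    (hw : ∑ u ∈ σ, w u = 1) : f (∑ u ∈ σ, w u • u) = ∑ u ∈ σ, w u • f u := by
  obtain ⟨g, hg⟩ := hfa s hs h3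
  have hmem : ∑ u ∈ σ, w u • u ∈ convexHull ℝ (s : Set E3) :=
    convexHull_mono (Finset.coe_subset.2 hσ) (Finset.mem_convexHull'.2 ⟨w, hw0, hw, rfl⟩)
  rw [hg hmem, AffineMap.map_sum_smul g hw]
  exact Finset.sum_congr rfl fun u hu => by rw [hg (subset_convexHull ℝ _ (hσ hu))]

open Classical in
lemma IsAffineOnTriangles.image_convexHull (hfa : IsAffineOnTriangles K f) (hs : s ∈ K.faces)
    (h3 : s.card = 3) {σ : Finset E3} (hσ : σ ⊆ s) :
    f '' convexHull ℝ (σ : Set E3) = convexHull ℝ ((σ.image f : Finset E2) : Set E2) := by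
  obtain ⟨g, hg⟩ := hfa s hs h3
  have hgσ : Set.EqOn f g (convexHull ℝ (σ : Set E3)) :=
    hg.mono (convexHull_mono (Finset.coe_subset.2 hσ))
  rw [hgσ.image_eq, AffineMap.image_convexHull, Finset.coe_image,
    (hgσ.mono (subset_convexHull ℝ _)).image_eq]

lemma IsAffineOnTriangles.injOn (hfa : IsAffineOnTriangles K f) (hfg : IsGeneralPosition K f)
    (hs : s ∈ K.faces) (h3 : s.card = 3) : Set.InjOn f (convexHull ℝ (s : Set E3)) := by
  intro x hx y hy hxy
  obtain ⟨w, hw0, hw1, rfl⟩ := Finset.mem_convexHull'.1 hx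
  obtain ⟨w', hw0', hw1', rfl⟩ := Finset.mem_convexHull'.1 hy
  rw [hfa.map_sum_smul hs h3 le_rfl hw0 hw1, hfa.map_sum_smul hs h3 le_rfl hw0' hw1'] at hxy
  have hind := hfg.affineIndependent hs h3
  have h1 := hind.eq_of_sum_eq_sum (s := Finset.univ) (w₁ := fun u : s => w u)
    (w₂ := fun u : s => w' u)
    (by rw [Finset.sum_coe_sort s w, Finset.sum_coe_sort s w', hw1, hw1'])
    (by rw [Finset.sum_coe_sort s (fun u => w u • f u), Finset.sum_coe_sort s (fun u => w' u • f u),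
      hxy])
  exact Finset.sum_congr rfl fun u hu => by rw [h1 ⟨u, hu⟩ (Finset.mem_univ _)]

lemma IsAffineOnTriangles.convex_image (hfa : IsAffineOnTriangles K f) (hs : s ∈ K.faces)
    (h3 : s.card = 3) : Convex ℝ (f '' convexHull ℝ (s : Set E3)) := by
  rw [hfa.image_convexHull hs h3 le_rfl]; exact convex_convexHull ℝ _

lemma IsAffineOnTriangles.isClosed_image (hfa : IsAffineOnTriangles K f) (hs : s ∈ K.faces)
    (h3 : s.card = 3) : IsClosed (f '' convexHull ℝ (s : Set E3)) := by
  rw [hfa.image_convexHull hs h3 le_rfl]; exact isClosed_convexHull_finset _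

lemma IsAffineOnTriangles.interior_image_nonempty (hfa : IsAffineOnTriangles K f)
    (hfg : IsGeneralPosition K f) (hs : s ∈ K.faces) (h3 : s.card = 3) :
    (interior (f '' convexHull ℝ (s : Set E3))).Nonempty := by
  rw [hfa.image_convexHull hs h3 le_rfl]
  exact interior_convexHull_nonempty (hfg.affineIndependent_image hs h3).1
    (by simp [(hfg.affineIndependent_image hs h3).2])

lemma collinear_of_dual_eq {l : E2 →L[ℝ] ℝ} (hl : l ≠ 0) (c : ℝ) :
    Collinear ℝ {x | l x = c} := by
  have hl' : (l : E2 →ₗ[ℝ] ℝ) ≠ 0 := fun h => hl (ContinuousLinearMap.coe_injective h)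
  rw [collinear_iff_finrank_le_one]
  have h1 : vectorSpan ℝ {x | l x = c} ≤ LinearMap.ker (l : E2 →ₗ[ℝ] ℝ) := by
    rw [vectorSpan_def, Submodule.span_le]
    rintro _ ⟨x, hx, y, hy, rfl⟩
    have hx' : l x = c := hx
    have hy' : l y = c := hy
    simp [hx', hy']
  have h2 := Submodule.finrank_mono h1
  have h3 := Module.Dual.finrank_ker_add_one_of_ne_zero (f := (l : E2 →ₗ[ℝ] ℝ)) hl'
  simp only [finrank_euclideanSpace, Fintype.card_fin] at h3
  omega

/-- The carrier of a point of a simplex. -/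
lemma exists_pos_weights {V : Type*} [AddCommGroup V] [Module ℝ V] {s : Finset V} {x : V}
    (hx : x ∈ convexHull ℝ (s : Set V)) : ∃ σ ⊆ s, ∃ w : V → ℝ, (∀ u ∈ σ, 0 < w u) ∧
      ∑ u ∈ σ, w u = 1 ∧ ∑ u ∈ σ, w u • u = x := by
  classical
  obtain ⟨w, hw0, hw1, hwx⟩ := Finset.mem_convexHull'.1 hx
  refine ⟨s.filter fun u => 0 < w u, Finset.filter_subset _ _, w,
    fun u hu => (Finset.mem_filter.1 hu).2, ?_, ?_⟩
  · rw [← hw1]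
    refine Finset.sum_subset (Finset.filter_subset _ _) fun u hu hu' => ?_
    exact le_antisymm (not_lt.1 fun h => hu' (Finset.mem_filter.2 ⟨hu, h⟩)) (hw0 u hu)
  · rw [← hwx]
    refine Finset.sum_subset (Finset.filter_subset _ _) fun u hu hu' => ?_
    rw [le_antisymm (not_lt.1 fun h => hu' (Finset.mem_filter.2 ⟨hu, h⟩)) (hw0 u hu), zero_smul]

/-- A linear functional that attains its maximum over a triangle image at `f x` is constant on
the image of the carrier of `x`. -/
lemma IsAffineOnTriangles.dual_eq_of_carrier (hfa : IsAffineOnTriangles K f) (hs : s ∈ K.faces)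
    (h3 : s.card = 3) {σ : Finset E3} (hσ : σ ⊆ s) {w : E3 → ℝ} (hw0 : ∀ u ∈ σ, 0 < w u)
    (hw : ∑ u ∈ σ, w u = 1) {l : E2 →L[ℝ] ℝ} {c : ℝ} (hl : ∀ u ∈ σ, l (f u) ≤ c)
    (hc : l (f (∑ u ∈ σ, w u • u)) = c) : ∀ u ∈ σ, l (f u) = c := by
  rw [hfa.map_sum_smul hs h3 hσ (fun u hu => (hw0 u hu).le) hw, map_sum] at hc
  simp only [map_smul, smul_eq_mul] at hc
  have h1 : ∑ u ∈ σ, w u * (c - l (f u)) = 0 := by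
    simp only [mul_sub, Finset.sum_sub_distrib, hc, ← Finset.sum_mul, hw]; ring
  intro u hu
  have h2 := (Finset.sum_eq_zero_iff_of_nonneg fun u hu =>
    mul_nonneg (hw0 u hu).le (sub_nonneg.2 (hl u hu))).1 h1 u hu
  rcases mul_eq_zero.1 h2 with h | h
  · exact absurd h (hw0 u hu).ne'
  · linarith

/-- The images of triangles that contain two distinct neighbors overlap. -/
lemma interior_inter_interior_nonempty (hfa : IsAffineOnTriangles K f)
    (hfg : IsGeneralPosition K f) (hs : s ∈ K.faces) (h3 : s.card = 3) (hs' : s' ∈ K.faces)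
    (h3' : s'.card = 3) {a b : E3} (ha : a ∈ convexHull ℝ (s : Set E3))
    (hb : b ∈ convexHull ℝ (s' : Set E3)) (hab : a ≠ b) (hfab : f a = f b) :
    (interior (f '' convexHull ℝ (s : Set E3)) ∩
      interior (f '' convexHull ℝ (s' : Set E3))).Nonempty := by
  by_contra hdisj
  rw [Set.not_nonempty_iff_eq_empty, ← Set.disjoint_iff_inter_eq_empty] at hdisj
  have hA := hfa.convex_image hs h3
  have hA' := hfa.convex_image hs' h3'
  obtain ⟨z, hz⟩ := hfa.interior_image_nonempty hfg hs h3
  obtain ⟨z', hz'⟩ := hfa.interior_image_nonempty hfg hs' h3'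
  -- The line `l = c` separates the images, so it contains `f a = f b` and the images of all
  -- vertices of the carriers `σ` of `a` and `τ` of `b`. General position then leaves two cases.
  -- Either one carrier contains the other, contrary to injectivity on a triangle, or the carriers
  -- are two distinct vertices, whose images differ.
  obtain ⟨l, c, hlt, hgt⟩ := geometric_hahn_banach_open_open hA.interior isOpen_interior
    hA'.interior isOpen_interior hdisj
  have hl0 : l ≠ 0 := by
    rintro rfl
    have h1 := hlt z hz
    have h2 := hgt z' hz'
    simp only [zero_apply] at h1 h2
    linarith
  have hle : ∀ y ∈ f '' convexHull ℝ (s : Set E3), l y ≤ c := by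
    intro y hy
    have h1 := hA.closure_interior_eq_closure_of_nonempty_interior ⟨z, hz⟩
    have h2 : closure (interior (f '' convexHull ℝ (s : Set E3))) ⊆ {y | l y ≤ c} :=
      closure_minimal (fun y hy => (hlt y hy).le) (isClosed_le l.continuous continuous_const)
    exact h2 (h1 ▸ subset_closure hy)
  have hge : ∀ y ∈ f '' convexHull ℝ (s' : Set E3), c ≤ l y := by
    intro y hy
    have h1 := hA'.closure_interior_eq_closure_of_nonempty_interior ⟨z', hz'⟩
    have h2 : closure (interior (f '' convexHull ℝ (s' : Set E3))) ⊆ {y | c ≤ l y} :=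
      closure_minimal (fun y hy => (hgt y hy).le) (isClosed_le continuous_const l.continuous)
    exact h2 (h1 ▸ subset_closure hy)
  have hc : l (f a) = c :=
    le_antisymm (hle _ ⟨a, ha, rfl⟩) (hfab ▸ hge _ ⟨b, hb, rfl⟩)
  have hinj := hfa.injOn hfg hs h3
  have hinj' := hfa.injOn hfg hs' h3'
  obtain ⟨σ, hσs, w, hw0, hw1, hwa⟩ := exists_pos_weights ha
  obtain ⟨τ, hτs, w', hw0', hw1', hwb⟩ := exists_pos_weights hb
  have hσl : ∀ u ∈ σ, l (f u) = c :=
    hfa.dual_eq_of_carrier hs h3 hσs hw0 hw1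
      (fun u hu => hle _ ⟨u, subset_convexHull ℝ _ (hσs hu), rfl⟩) (by rw [hwa, hc])
  have hτl : ∀ u ∈ τ, l (f u) = c := by
    intro u hu
    have := hfa.dual_eq_of_carrier hs' h3' hτs hw0' hw1' (l := -l) (c := -c)
      (fun u hu => by
        simpa using hge _ ⟨u, subset_convexHull ℝ _ (hτs hu), rfl⟩)
      (by rw [hwb, ← hfab]; simp [hc]) u hu
    simpa using this
  have hσK : ∀ u ∈ σ, u ∈ K.vertices := fun u hu => mem_vertices_of_mem hs (hσs hu)
  have hτK : ∀ u ∈ τ, u ∈ K.vertices := fun u hu => mem_vertices_of_mem hs' (hτs hu)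
  have haσ : a ∈ convexHull ℝ (σ : Set E3) :=
    Finset.mem_convexHull'.2 ⟨w, fun u hu => (hw0 u hu).le, hw1, hwa⟩
  have hbτ : b ∈ convexHull ℝ (τ : Set E3) :=
    Finset.mem_convexHull'.2 ⟨w', fun u hu => (hw0' u hu).le, hw1', hwb⟩
  have hthree : ∀ u v x, u ∈ K.vertices → v ∈ K.vertices → x ∈ K.vertices → l (f u) = c →
      l (f v) = c → l (f x) = c → u ≠ v → v ≠ x → u ≠ x → False := by
    intro u v x hu hv hx lu lv lx huv hvx hux
    refine hfg u hu v hv x hx huv hvx hux ((collinear_of_dual_eq hl0 c).subset ?_)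
    rintro y (rfl | rfl | rfl)
    exacts [lu, lv, lx]
  by_cases hτσ : τ ⊆ σ
  · have hb' : b ∈ convexHull ℝ (s : Set E3) :=
      convexHull_mono (Finset.coe_subset.2 (hτσ.trans hσs)) hbτ
    exact hab (hinj ha hb' hfab)
  by_cases hστ : σ ⊆ τ
  · have ha' : a ∈ convexHull ℝ (s' : Set E3) :=
      convexHull_mono (Finset.coe_subset.2 (hστ.trans hτs)) haσ
    exact hab (hinj' ha' hb hfab)
  obtain ⟨v, hvτ, hvσ⟩ := Finset.not_subset.1 hτσ
  obtain ⟨u, huσ, huτ⟩ := Finset.not_subset.1 hστ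
  have huv : u ≠ v := fun h => huτ (h ▸ hvτ)
  have hσu : σ = {u} := by
    refine Finset.eq_singleton_iff_unique_mem.2 ⟨huσ, fun x hx => ?_⟩
    by_contra hxu
    exact hthree u v x (hσK u huσ) (hτK v hvτ) (hσK x hx) (hσl u huσ) (hτl v hvτ) (hσl x hx) huv
      (fun h => hvσ (h ▸ hx)) (Ne.symm hxu)
  have hτv : τ = {v} := by
    refine Finset.eq_singleton_iff_unique_mem.2 ⟨hvτ, fun x hx => ?_⟩
    by_contra hxv
    exact hthree u v x (hσK u huσ) (hτK v hvτ) (hτK x hx) (hσl u huσ) (hτl v hvτ) (hτl x hx) huv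
      (Ne.symm hxv) (fun h => huτ (h ▸ hx))
  have hau : a = u := by simpa [hσu] using haσ
  have hbv : b = v := by simpa [hτv] using hbτ
  refine hfg.map_ne hs h3 (hσK u huσ) (hτK v hvτ) huv ?_
  rw [← hau, ← hbv, hfab]

end AffineTriangles

/-! ### Convex pieces of the closure of the set of distinct neighbors -/

section Overlaps

variable {B : Set E3} {K : Geometry.SimplicialComplex ℝ E3} {f : E3 → E2} {s s' : Finset E3}

/-- The ordered pairs of distinct triangles of `K` whose images overlap. -/
def overlappingPairs (K : Geometry.SimplicialComplex ℝ E3) (f : E3 → E2) :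
    Set (Finset E3 × Finset E3) :=
  {q | (q.1 ∈ K.faces ∧ q.1.card = 3) ∧ (q.2 ∈ K.faces ∧ q.2.card = 3) ∧ q.1 ≠ q.2 ∧
    (interior (f '' convexHull ℝ (q.1 : Set E3)) ∩
      interior (f '' convexHull ℝ (q.2 : Set E3))).Nonempty}

lemma finite_overlappingPairs (hK : K.faces.Finite) : (overlappingPairs K f).Finite :=
  (hK.prod hK).subset fun _ hq => ⟨hq.1.1, hq.2.1.1⟩

lemma isClosed_neighborTriangle (hfa : IsAffineOnTriangles K f) (hs : s ∈ K.faces)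
    (h3 : s.card = 3) (hs' : s' ∈ K.faces) (h3' : s'.card = 3) :
    IsClosed (neighborTriangle f (convexHull ℝ (s : Set E3)) (convexHull ℝ (s' : Set E3))) := by
  obtain ⟨g, hg⟩ := hfa s hs h3
  obtain ⟨g', hg'⟩ := hfa s' hs' h3'
  have hgc : Continuous g := g.continuous_of_finiteDimensional
  have hgc' : Continuous g' := g'.continuous_of_finiteDimensional
  have : neighborTriangle f (convexHull ℝ (s : Set E3)) (convexHull ℝ (s' : Set E3)) =
      (convexHull ℝ (s : Set E3) ×ˢ convexHull ℝ (s' : Set E3)) ∩ {x | g x.1 = g' x.2} := by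
    ext x
    constructor
    · rintro ⟨h1, h2, h⟩
      exact ⟨⟨h1, h2⟩, by rw [Set.mem_ofPred_eq, ← hg h1, ← hg' h2, h]⟩
    · rintro ⟨⟨h1, h2⟩, h⟩
      exact ⟨h1, h2, by rw [hg h1, hg' h2]; exact h⟩
  rw [this]
  exact ((isClosed_convexHull_finset s).prod (isClosed_convexHull_finset s')).inter
    (isClosed_eq (by fun_prop) (by fun_prop))

/-- On the product of two triangles, coincidence is the equality of two affine maps. Convexity
allows a polygonal path to reach any point of a piece by a single segment. -/
lemma convex_neighborTriangle (hfa : IsAffineOnTriangles K f) (hs : s ∈ K.faces)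
    (h3 : s.card = 3) (hs' : s' ∈ K.faces) (h3' : s'.card = 3) :
    Convex ℝ (neighborTriangle f (convexHull ℝ (s : Set E3)) (convexHull ℝ (s' : Set E3))) := by
  obtain ⟨g, hg⟩ := hfa s hs h3
  obtain ⟨g', hg'⟩ := hfa s' hs' h3'
  rintro x ⟨hx1, hx2, hx⟩ y ⟨hy1, hy2, hy⟩ t r ht hr htr
  have h1 := convex_convexHull ℝ (s : Set E3) hx1 hy1 ht hr htr
  have h2 := convex_convexHull ℝ (s' : Set E3) hx2 hy2 ht hr htr
  refine ⟨h1, h2, ?_⟩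
  have e1 := hg h1
  have e2 := hg' h2
  rw [Convex.combo_affine_apply htr, ← hg hx1, ← hg hy1] at e1
  rw [Convex.combo_affine_apply htr, ← hg' hx2, ← hg' hy2] at e2
  exact e1.trans ((by rw [hx, hy] : _ = _).trans e2.symm)

/-- Distinct triangles share at most two vertices, so their intersection has an image inside a
segment. -/
lemma interior_image_inter_eq_empty (hfa : IsAffineOnTriangles K f) (hs : s ∈ K.faces)
    (h3 : s.card = 3) (hs' : s' ∈ K.faces) (h3' : s'.card = 3) (hne : s ≠ s') :
    interior (f '' (convexHull ℝ (s : Set E3) ∩ convexHull ℝ (s' : Set E3))) = ∅ := by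
  classical
  rw [K.convexHull_inter_convexHull hs hs', ← Finset.coe_inter,
    hfa.image_convexHull hs h3 Finset.inter_subset_left]
  refine interior_convexHull_eq_empty (Finset.card_image_le.trans ?_)
  simp only [finrank_euclideanSpace, Fintype.card_fin]
  by_contra hcard
  have h1 : s ∩ s' = s :=
    Finset.eq_of_subset_of_card_le Finset.inter_subset_left (by omega)
  have h2 : s ∩ s' = s' :=
    Finset.eq_of_subset_of_card_le Finset.inter_subset_right (by omega)
  exact hne (h1.symm.trans h2)

/-- The closure of the set of distinct neighbors is a finite union of convex sets. -/
theorem closure_distinctNeighbors_eq (hB : IsConvexPolyhedron B)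
    (hK : IsTriangulationOf K (frontier B)) (hfa : IsAffineOnTriangles K f)
    (hfg : IsGeneralPosition K f) :
    closure (distinctNeighbors (frontier B) f) = ⋃ q ∈ overlappingPairs K f,
      neighborTriangle f (convexHull ℝ (q.1 : Set E3)) (convexHull ℝ (q.2 : Set E3)) := by
  apply Set.Subset.antisymm
  · refine closure_minimal ?_ ((finite_overlappingPairs hK.1).isClosed_biUnion fun q hq =>
      isClosed_neighborTriangle hfa hq.1.1 hq.1.2 hq.2.1.1 hq.2.1.2)
    rintro ⟨a, b⟩ ⟨ha, hb, hab, hfab⟩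
    obtain ⟨s, hs, h3, has⟩ := hK.exists_triangle hB ha
    obtain ⟨s', hs', h3', hbs⟩ := hK.exists_triangle hB hb
    refine Set.mem_biUnion (x := (s, s')) ⟨⟨hs, h3⟩, ⟨hs', h3'⟩, ?_,
      interior_inter_interior_nonempty hfa hfg hs h3 hs' h3' has hbs hab hfab⟩ ⟨has, hbs, hfab⟩
    intro (h : s = s')
    subst h
    exact hab (hfa.injOn hfg hs h3 has hbs hfab)
  · refine Set.iUnion₂_subset ?_
    rintro ⟨s, s'⟩ ⟨⟨hs, h3⟩, ⟨hs', h3'⟩, hne, hO⟩ x hx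
    simp only at hs h3 hs' h3' hne hO hx
    -- The image of the common face cannot fill the open overlap, so some point of the overlap has
    -- different preimages in `s` and `s'`. Moving from `x` towards this pair gives distinct
    -- neighbors near `x`.
    obtain ⟨z, hz, hzne⟩ : ∃ z ∈ interior (f '' convexHull ℝ (s : Set E3)) ∩
        interior (f '' convexHull ℝ (s' : Set E3)),
        z ∉ f '' (convexHull ℝ (s : Set E3) ∩ convexHull ℝ (s' : Set E3)) := by
      by_contra! hsub
      have h1 := interior_maximal (s := f '' (convexHull ℝ (s : Set E3) ∩
        convexHull ℝ (s' : Set E3))) hsub (isOpen_interior.inter isOpen_interior)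
      rw [interior_image_inter_eq_empty hfa hs h3 hs' h3' hne] at h1
      exact (hO.mono h1).ne_empty rfl
    obtain ⟨a, ha, haz⟩ := interior_subset hz.1
    obtain ⟨b, hb, hbz⟩ := interior_subset hz.2
    have hab : a ≠ b := by
      rintro rfl
      exact hzne ⟨a, ⟨ha, hb⟩, haz⟩
    have hy : (a, b) ∈ neighborTriangle f (convexHull ℝ (s : Set E3))
        (convexHull ℝ (s' : Set E3)) := ⟨ha, hb, haz.trans hbz.symm⟩
    have hconv := convex_neighborTriangle hfa hs h3 hs' h3'
    set γ : ℝ → E3 × E3 := fun t => (1 - t) • x + t • (a, b) with hγ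
    have hγc : Continuous γ := by simp only [hγ]; fun_prop
    have hγ0 : Filter.Tendsto γ (𝓝[>] 0) (𝓝 x) := by
      have : γ 0 = x := by simp [hγ]
      rw [← this]
      exact hγc.continuousAt.mono_left nhdsWithin_le_nhds
    have hP : ∀ {s : Finset E3}, s ∈ K.faces → convexHull ℝ (s : Set E3) ⊆ frontier B :=
      fun hs => (K.convexHull_subset_space hs).trans hK.2.subset
    refine mem_closure_of_tendsto hγ0 ?_
    have h1 : ∀ᶠ t in 𝓝[>] (0 : ℝ), t < 1 := nhdsWithin_le_nhds (gt_mem_nhds one_pos)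
    have h2 : ∀ᶠ t in 𝓝[>] (0 : ℝ), 0 < t := self_mem_nhdsWithin
    -- From a diagonal point the two coordinates separate by `t • (a - b)`; off the diagonal,
    -- distinctness is an open condition.
    have h3 : ∀ᶠ t in 𝓝[>] (0 : ℝ), (γ t).1 ≠ (γ t).2 := by
      by_cases hx12 : x.1 = x.2
      · filter_upwards [h2] with t ht h
        simp only [hγ, Prod.fst_add, Prod.snd_add, Prod.smul_fst, Prod.smul_snd, hx12,
          add_right_inj] at h
        exact hab (smul_right_injective _ ht.ne' h)
      · have h4 : ∀ᶠ t in 𝓝 (0 : ℝ), (γ t).1 ≠ (γ t).2 := by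
          have h5 : IsOpen {t | (γ t).1 ≠ (γ t).2} :=
            isOpen_ne_fun (continuous_fst.comp hγc) (continuous_snd.comp hγc)
          exact h5.mem_nhds (by simpa [hγ] using hx12)
        exact nhdsWithin_le_nhds h4
    filter_upwards [h1, h2, h3] with t ht1 ht0 hne'
    have h6 := hconv hx hy (by linarith : 0 ≤ 1 - t) ht0.le (by ring)
    exact ⟨hP hs h6.1, hP hs' h6.2.1, hne', h6.2.2⟩

end Overlaps

/-! ### Operations on polygonal paths and antipodal pairs -/

section PolygonalPaths

variable {S : Set (E3 × E3)} {x y z : E3 × E3}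

lemma PolygonallyJoined.mem_right (h : PolygonallyJoined S x y) : y ∈ S := by
  obtain ⟨n, v, h0, hn, hx, hseg⟩ := h
  rcases n with _ | n
  · rwa [← hn, h0]
  · rw [← hn]; exact hseg n (Nat.lt_succ_self n) (right_mem_segment ℝ _ _)

lemma PolygonallyJoined.snoc (h : PolygonallyJoined S x y) (hyz : segment ℝ y z ⊆ S) :
    PolygonallyJoined S x z := by
  obtain ⟨n, v, h0, hn, hx, hseg⟩ := h
  refine ⟨n + 1, fun i => if i ≤ n then v i else z, by simp [h0], by simp, hx, fun i hi => ?_⟩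
  rcases Nat.lt_succ_iff_lt_or_eq.1 hi with h | rfl
  · have h1 : i + 1 ≤ n := h
    simpa [h.le, h1] using hseg i h
  · simpa [hn] using hyz

lemma PolygonallyJoined.swap (hS : ∀ x ∈ S, x.swap ∈ S) (h : PolygonallyJoined S x y) :
    PolygonallyJoined S x.swap y.swap := by
  obtain ⟨n, v, h0, hn, hx, hseg⟩ := h
  refine ⟨n, fun i => (v i).swap, by simp [h0], by simp [hn], hS x hx, fun i hi w hw => ?_⟩
  obtain ⟨a, b, ha, hb, hab, rfl⟩ := hw
  have := hS _ (hseg i hi ⟨a, b, ha, hb, hab, rfl⟩)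
  simpa using this

lemma Antipodal.symm {B : Set E3} {p a b : E3} (h : Antipodal B p a b) : Antipodal B p b a :=
  ⟨h.2.1, h.1, openSegment_symm ℝ a b ▸ h.2.2⟩

end PolygonalPaths

/-! ### Existence of the path in the closure -/

section Joining

variable {B : Set E3} {K : Geometry.SimplicialComplex ℝ E3} {f : E3 → E2}

/-- Coincidence pairs join an antipodal pair to a diagonal pair. -/
theorem joinsAntipodalToDiagonal_closure (hB : IsConvexPolyhedron B)
    (hK : IsTriangulationOf K (frontier B)) (hf : ContinuousOn f (frontier B))
    (hfa : IsAffineOnTriangles K f) (hfg : IsGeneralPosition K f) {p : E3} (hp : p ∈ interior B) :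
    JoinsAntipodalToDiagonal B p (closure (distinctNeighbors (frontier B) f)) := by
  set N : Finset E3 × Finset E3 → Set (E3 × E3) := fun q =>
    neighborTriangle f (convexHull ℝ (q.1 : Set E3)) (convexHull ℝ (q.2 : Set E3)) with hN
  set F := closure (distinctNeighbors (frontier B) f) with hF
  have hFN : F = ⋃ q ∈ overlappingPairs K f, N q :=
    closure_distinctNeighbors_eq hB hK hfa hfg
  have hNclosed : ∀ q ∈ overlappingPairs K f, IsClosed (N q) := fun q hq =>
    isClosed_neighborTriangle hfa hq.1.1 hq.1.2 hq.2.1.1 hq.2.1.2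
  have hNF : ∀ q ∈ overlappingPairs K f, N q ⊆ F := fun q hq => by
    rw [hFN]; exact Set.subset_biUnion_of_mem hq
  have hNseg : ∀ q ∈ overlappingPairs K f, ∀ x ∈ N q, ∀ y ∈ N q, segment ℝ x y ⊆ F :=
    fun q hq x hx y hy => ((convex_neighborTriangle hfa hq.1.1 hq.1.2 hq.2.1.1
      hq.2.1.2).segment_subset hx hy).trans (hNF q hq)
  have hFf : ∀ x ∈ F, f x.1 = f x.2 := by
    intro x hx
    rw [hFN] at hx
    obtain ⟨q, -, hxq⟩ := Set.mem_iUnion₂.1 hx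
    exact hxq.2.2
  have hFswap : ∀ x ∈ F, x.swap ∈ F := fun x hx =>
    map_mem_closure continuous_swap hx fun y hy => ⟨hy.2.1, hy.1, hy.2.2.1.symm, hy.2.2.2.symm⟩
  set F₁ : Set (E3 × E3) := {x | ∃ a b, Antipodal B p a b ∧ PolygonallyJoined F (a, b) x} with hF₁
  have hF₁F : F₁ ⊆ F := by
    rintro x ⟨a, b, -, h⟩; exact h.mem_right
  have hstep : ∀ q ∈ overlappingPairs K f, ∀ x ∈ N q, x ∈ F₁ → N q ⊆ F₁ := by
    rintro q hq x hx ⟨a, b, hab, h⟩ y hy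
    exact ⟨a, b, hab, h.snoc (hNseg q hq x hx y hy)⟩
  -- A subset of `F` that contains every piece it meets is a finite union of closed pieces. This
  -- applies both to `F₁` and to its complement in `F`.
  have hclosed : ∀ A : Set (E3 × E3), A ⊆ F →
      (∀ q ∈ overlappingPairs K f, ∀ x ∈ N q, x ∈ A → N q ⊆ A) → IsClosed A := by
    intro A hAF hA
    have : A = ⋃ q ∈ {q ∈ overlappingPairs K f | N q ⊆ A}, N q := by
      ext x
      constructor
      · intro hx
        have hxF := hAF hx
        rw [hFN] at hxF
        obtain ⟨q, hq, hxq⟩ := Set.mem_iUnion₂.1 hxF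
        exact Set.mem_iUnion₂.2 ⟨q, ⟨hq, hA q hq x hxq hx⟩, hxq⟩
      · intro hx
        obtain ⟨q, hq, hxq⟩ := Set.mem_iUnion₂.1 hx
        exact hq.2 hxq
    rw [this]
    exact ((finite_overlappingPairs hK.1).subset fun q hq => hq.1).isClosed_biUnion
      fun q hq => hNclosed q hq.1
  have hs₁ : ∀ x ∈ F₁, x.swap ∈ F₁ := by
    rintro x ⟨a, b, hab, h⟩
    exact ⟨b, a, hab.symm, h.swap hFswap⟩
  by_contra hno
  refine false_of_separated_neighbors hB.convex hB.isCompact hp hf (F₁ := F₁) (F₂ := F \ F₁)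
    (hclosed F₁ hF₁F hstep) (hclosed _ Set.sdiff_subset ?_) Set.disjoint_sdiff_right hs₁ ?_
    (fun x hx => hFf x (hF₁F hx)) (fun x hx => hFf x hx.1) ?_ ?_ ?_
  · intro q hq x hx hx' y hy
    exact ⟨hNF q hq hy, fun hy' => hx'.2 (hstep q hq y hy hy' hx)⟩
  · rintro x ⟨hx, hx'⟩
    exact ⟨hFswap x hx, fun h => hx' (by simpa using hs₁ _ h)⟩
  · intro x hx
    by_cases h : x ∈ F₁
    · exact Or.inl h
    · exact Or.inr ⟨subset_closure hx, h⟩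
  · rintro c ⟨a, b, hab, h⟩
    exact hno ⟨a, b, c, hab, h⟩
  · rintro a b hab ⟨h, h'⟩
    -- The path without segments puts every antipodal pair of `F` into `F₁`.
    exact h' ⟨a, b, hab, 0, fun _ => (a, b), rfl, rfl, h, fun i hi => absurd hi (Nat.not_lt_zero i)⟩

end Joining

/-! ### Comparison with the complex defined by the triangulation of the image -/

section ImageTriangulation

variable {B : Set E3} {K : Geometry.SimplicialComplex ℝ E3} {f : E3 → E2}
  {T : Geometry.SimplicialComplex ℝ E2} {s s' : Finset E3} {t : Finset E2}

/-- Every vertex lies in a triangle, two of whose edges end there. Hence the ends of each edge image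
are among its cutting points. -/
lemma map_vertex_mem_edgeCrossings (hB : IsConvexPolyhedron B)
    (hK : IsTriangulationOf K (frontier B)) {u : E3} (hu : u ∈ K.vertices) :
    f u ∈ edgeCrossings K f := by
  classical
  obtain ⟨s, hs, h3, hus⟩ := hK.exists_triangle_superset hB (show {u} ∈ K.faces from hu)
  rw [Finset.singleton_subset_iff] at hus
  have hcard : (s.erase u).card = 2 := by rw [Finset.card_erase_of_mem hus, h3]
  obtain ⟨v, w, hvw, hvws⟩ := Finset.card_eq_two.1 hcard
  have hv : v ∈ s.erase u := by simp [hvws]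
  have hw : w ∈ s.erase u := by simp [hvws]
  have hvu := Finset.ne_of_mem_erase hv
  have hwu := Finset.ne_of_mem_erase hw
  have hedge : ∀ x ∈ s, ({u, x} : Finset E3) ∈ K.faces := fun x hx =>
    K.down_closed hs (by simp [Finset.insert_subset_iff, hus, hx]) (by simp)
  have hmem : ∀ x, f u ∈ f '' convexHull ℝ (({u, x} : Finset E3) : Set E3) := fun x =>
    ⟨u, subset_convexHull ℝ _ (by simp), rfl⟩
  refine ⟨{u, v}, hedge v (Finset.mem_of_mem_erase hv), {u, w},
    hedge w (Finset.mem_of_mem_erase hw), Finset.card_pair hvu.symm, Finset.card_pair hwu.symm,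
    fun h => ?_, hmem v, hmem w⟩
  have h1 : v ∈ ({u, w} : Finset E3) := h ▸ by simp
  simp [hvu, hvw] at h1

/-- Two simplices of `T` meet in the hull of their common vertices; here these span a proper face of
the triangle. -/
lemma disjoint_face_interior_triangle {c : Finset E2} (hc : c ∈ T.faces) (hc2 : c.card ≤ 2)
    (ht : t ∈ T.faces) (h3 : t.card = 3) :
    Disjoint (convexHull ℝ (c : Set E2)) (interior (convexHull ℝ (t : Set E2))) := by
  classical
  rw [Set.disjoint_left]
  intro x hx hxt
  have h1 := T.inter_subset_convexHull hc ht ⟨hx, interior_subset hxt⟩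
  rw [← Finset.coe_inter] at h1
  refine Set.disjoint_left.1 (disjoint_convexHull_interior_of_ssubset (T.indep ht)
    (by simp [h3]) ?_) h1 hxt
  refine Finset.ssubset_iff_subset_ne.2 ⟨Finset.inter_subset_right, fun h => ?_⟩
  have h2 := Finset.card_le_card (Finset.inter_subset_left (s₁ := c) (s₂ := t))
  rw [h] at h2
  omega

/-- A point of an edge image which is not a crossing lies in one of the segments into which the
crossings cut the edge image. -/
lemma exists_constraint (hB : IsConvexPolyhedron B) (hK : IsTriangulationOf K (frontier B))
    (hfa : IsAffineOnTriangles K f) (hfg : IsGeneralPosition K f)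
    (hfin : (edgeCrossings K f).Finite) {e : Finset E3} (he : e ∈ K.faces) (he2 : e.card = 2)
    {y : E2} (hy : y ∈ f '' convexHull ℝ (e : Set E3)) (hyc : y ∉ edgeCrossings K f) :
    ∃ c ∈ constraints K f, c.card = 2 ∧ y ∈ convexHull ℝ (c : Set E2) := by
  classical
  obtain ⟨s, hs, h3, hes⟩ := hK.exists_triangle_superset hB he
  have himage := hfa.image_convexHull hs h3 hes
  obtain ⟨u, v, huv, rfl⟩ := Finset.card_eq_two.1 he2
  have hu : u ∈ K.vertices := mem_vertices_of_mem he (by simp)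
  have hv : v ∈ K.vertices := mem_vertices_of_mem he (by simp)
  have hfuv : f u ≠ f v := hfg.map_ne hs h3 hu hv huv
  rw [Finset.image_insert, Finset.image_singleton, Finset.coe_pair, Finset.coe_pair,
    convexHull_pair, convexHull_pair] at himage
  set γ : ℝ →ᵃ[ℝ] E2 := AffineMap.lineMap (f u) (f v) with hγ
  have hγinj : Function.Injective γ := AffineMap.lineMap_injective ℝ hfuv
  have hγ0 : γ 0 = f u := AffineMap.lineMap_apply_zero _ _
  have hγ1 : γ 1 = f v := AffineMap.lineMap_apply_one _ _
  have hseg : segment ℝ (f u) (f v) = γ '' Set.Icc 0 1 := segment_eq_image_lineMap ℝ _ _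
  rw [Finset.coe_pair, convexHull_pair, himage, hseg] at hy
  obtain ⟨r, ⟨hr0, hr1⟩, rfl⟩ := hy
  -- These are the parameters of the crossings on the edge image, including 0 and 1. Those nearest
  -- to `r` on either side bound the required constraint.
  set R : Set ℝ := {q | q ∈ Set.Icc (0 : ℝ) 1 ∧ γ q ∈ edgeCrossings K f} with hR
  have hRfin : R.Finite := (hfin.preimage hγinj.injOn).subset fun q hq => hq.2
  have h0R : (0 : ℝ) ∈ R := ⟨by simp, hγ0 ▸ map_vertex_mem_edgeCrossings hB hK hu⟩
  have h1R : (1 : ℝ) ∈ R := ⟨by simp, hγ1 ▸ map_vertex_mem_edgeCrossings hB hK hv⟩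
  have hrR : ∀ q ∈ R, q ≠ r := by rintro q hq rfl; exact hyc hq.2
  obtain ⟨q₁, ⟨hq₁R, hq₁r⟩, hq₁max⟩ := Set.exists_max_image (R ∩ Set.Iio r) id
    (hRfin.inter_of_left _) ⟨0, h0R, lt_of_le_of_ne hr0 (hrR 0 h0R)⟩
  obtain ⟨q₂, ⟨hq₂R, hq₂r⟩, hq₂min⟩ := Set.exists_min_image (R ∩ Set.Ioi r) id
    (hRfin.inter_of_left _) ⟨1, h1R, lt_of_le_of_ne hr1 (hrR 1 h1R).symm⟩
  have hq₁r' : q₁ < r := hq₁r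
  have hq₂r' : r < q₂ := hq₂r
  have hq : q₁ < q₂ := hq₁r'.trans hq₂r'
  have hopen : openSegment ℝ (γ q₁) (γ q₂) = γ '' Set.Ioo q₁ q₂ := by
    rw [← image_openSegment, openSegment_eq_Ioo hq]
  have hmemE : ∀ q ∈ R, γ q ∈ f '' convexHull ℝ ((({u, v} : Finset E3)) : Set E3) := by
    intro q hq
    rw [Finset.coe_pair, convexHull_pair, himage, hseg]
    exact ⟨q, hq.1, rfl⟩
  have hne : γ q₁ ≠ γ q₂ := fun h => hq.ne (hγinj h)
  refine ⟨{γ q₁, γ q₂}, ⟨{u, v}, he, he2, γ q₁, γ q₂, hne, rfl, hq₁R.2, hq₂R.2, hmemE q₁ hq₁R,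
    hmemE q₂ hq₂R, ?_⟩, Finset.card_pair hne, ?_⟩
  · rw [hopen, Set.disjoint_left]
    rintro _ ⟨q, ⟨h1, h2⟩, rfl⟩ hqc
    have hqR : q ∈ R := ⟨⟨hq₁R.1.1.trans h1.le, h2.le.trans hq₂R.1.2⟩, hqc⟩
    rcases lt_or_gt_of_ne (hrR q hqR) with h | h
    · exact absurd (hq₁max q ⟨hqR, h⟩) (not_le.2 h1)
    · exact absurd (hq₂min q ⟨hqR, h⟩) (not_le.2 h2)
  · rw [Finset.coe_pair, convexHull_pair]
    apply openSegment_subset_segment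
    rw [hopen]
    exact ⟨r, ⟨hq₁r', hq₂r'⟩, rfl⟩

lemma IsImageTriangulation.finite_edgeCrossings (hT : IsImageTriangulation K f T) :
    (edgeCrossings K f).Finite := by
  rw [← hT.vertices_eq, Geometry.SimplicialComplex.vertices_eq]
  exact hT.finite.biUnion fun c _ => c.finite_toSet

/-- The interiors of the triangles of `T` are not met by the edge images. -/
lemma IsImageTriangulation.disjoint_edge (hT : IsImageTriangulation K f T)
    (hB : IsConvexPolyhedron B) (hK : IsTriangulationOf K (frontier B))
    (hfa : IsAffineOnTriangles K f) (hfg : IsGeneralPosition K f) {e : Finset E3}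
    (he : e ∈ K.faces) (he2 : e.card = 2) (ht : t ∈ T.faces) (h3 : t.card = 3) :
    Disjoint (f '' convexHull ℝ (e : Set E3)) (interior (convexHull ℝ (t : Set E2))) := by
  rw [Set.disjoint_left]
  intro y hy hyt
  by_cases hyc : y ∈ edgeCrossings K f
  · rw [← hT.vertices_eq] at hyc
    exact Set.disjoint_left.1 (disjoint_face_interior_triangle (c := {y}) hyc (by simp) ht h3)
      (by simp) hyt
  · obtain ⟨c, hc, hc2, hyc'⟩ := exists_constraint hB hK hfa hfg hT.finite_edgeCrossings he he2
      hy hyc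
    exact Set.disjoint_left.1 (disjoint_face_interior_triangle (hT.constraints_subset hc) hc2.le
      ht h3) hyc' hyt

/-- A triangle of `T` whose interior meets the image of a triangle of `K` lies in this image. -/
lemma IsImageTriangulation.subset_image (hT : IsImageTriangulation K f T)
    (hB : IsConvexPolyhedron B) (hK : IsTriangulationOf K (frontier B))
    (hfa : IsAffineOnTriangles K f) (hfg : IsGeneralPosition K f) (hs : s ∈ K.faces)
    (hs3 : s.card = 3) (ht : t ∈ T.faces) (ht3 : t.card = 3)
    (h : (f '' convexHull ℝ (s : Set E3) ∩ interior (convexHull ℝ (t : Set E2))).Nonempty) :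
    convexHull ℝ (t : Set E2) ⊆ f '' convexHull ℝ (s : Set E3) ∧
      interior (convexHull ℝ (t : Set E2)) ⊆ interior (f '' convexHull ℝ (s : Set E3)) := by
  classical
  -- A boundary point of the image of `s` lies on an edge image, hence not in the interior of `t`.
  -- So this connected interior cannot leave the image once it meets it.
  have hedge : ∀ y ∈ f '' convexHull ℝ (s : Set E3), y ∈ interior (convexHull ℝ (t : Set E2)) →
      y ∈ interior (f '' convexHull ℝ (s : Set E3)) := by
    intro y hy hyt
    by_contra hyi
    rw [hfa.image_convexHull hs hs3 le_rfl] at hy hyi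
    have hind := hfg.affineIndependent_image hs hs3
    obtain ⟨_, hv, hyv⟩ := exists_mem_convexHull_erase hind.1 (by simp [hind.2]) hy hyi
    obtain ⟨u, hu, rfl⟩ := Finset.mem_image.1 hv
    have hsub : (s.image f).erase (f u) ⊆ (s.erase u).image f := by
      intro z hz
      obtain ⟨hzne, hz⟩ := Finset.mem_erase.1 hz
      obtain ⟨x, hx, rfl⟩ := Finset.mem_image.1 hz
      exact Finset.mem_image_of_mem f (Finset.mem_erase.2 ⟨fun h => hzne (h ▸ rfl), hx⟩)
    have hy' := convexHull_mono (Finset.coe_subset.2 hsub) hyv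
    rw [← hfa.image_convexHull hs hs3 (Finset.erase_subset u s)] at hy'
    have hcard : (s.erase u).card = 2 := by rw [Finset.card_erase_of_mem hu, hs3]
    exact Set.disjoint_left.1 (hT.disjoint_edge hB hK hfa hfg
      (K.down_closed hs (Finset.erase_subset u s) (Finset.card_pos.1 (by omega))) hcard ht ht3)
      hy' hyt
  have hconvt := convex_convexHull ℝ (t : Set E2)
  have hclosed := hfa.isClosed_image hs hs3
  have hint : interior (convexHull ℝ (t : Set E2)) ⊆
      interior (f '' convexHull ℝ (s : Set E3)) := by
    obtain ⟨y, hy, hyt⟩ := h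
    refine hconvt.interior.isPreconnected.subset_of_closure_inter_subset isOpen_interior
      ⟨y, hyt, hedge y hy hyt⟩ fun z hz => hedge z ?_ hz.2
    exact hclosed.closure_subset (closure_mono interior_subset hz.1)
  refine ⟨?_, hint⟩
  have h1 := hconvt.closure_interior_eq_closure_of_nonempty_interior
    (h.mono Set.inter_subset_right)
  exact (subset_closure.trans h1.symm.subset).trans
    (closure_minimal (hint.trans interior_subset) hclosed)

/-- The description of the induced triangles without closures. -/
lemma closure_inter_preimage_interior (hfa : IsAffineOnTriangles K f) (hs : s ∈ K.faces)
    (hs3 : s.card = 3)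
    (h : (convexHull ℝ (s : Set E3) ∩ f ⁻¹' interior (convexHull ℝ (t : Set E2))).Nonempty) :
    closure (convexHull ℝ (s : Set E3) ∩ f ⁻¹' interior (convexHull ℝ (t : Set E2))) =
      convexHull ℝ (s : Set E3) ∩ f ⁻¹' convexHull ℝ (t : Set E2) := by
  obtain ⟨g, hg⟩ := hfa s hs hs3
  have hgc : Continuous g := g.continuous_of_finiteDimensional
  have hpre : ∀ A : Set E2, convexHull ℝ (s : Set E3) ∩ f ⁻¹' A =
      convexHull ℝ (s : Set E3) ∩ g ⁻¹' A := by
    intro A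
    ext x
    exact and_congr_right fun hx => by rw [Set.mem_preimage, Set.mem_preimage, hg hx]
  rw [hpre] at h
  rw [hpre, hpre]
  apply Set.Subset.antisymm
  · exact closure_minimal (Set.inter_subset_inter_right _ (Set.preimage_mono interior_subset))
      ((isClosed_convexHull_finset s).inter ((isClosed_convexHull_finset t).preimage hgc))
  · obtain ⟨x₀, hx₀, hx₀t⟩ := h
    rintro x ⟨hx, hxt⟩
    -- An open segment from an interior point of a convex set to a point of the set stays in the
    -- interior, and `g` maps segments to segments.
    have hsub : openSegment ℝ x₀ x ⊆
        convexHull ℝ (s : Set E3) ∩ g ⁻¹' interior (convexHull ℝ (t : Set E2)) := by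
      intro z hz
      refine ⟨(convex_convexHull ℝ _).openSegment_subset hx₀ hx hz, ?_⟩
      refine (convex_convexHull ℝ (t : Set E2)).openSegment_interior_closure_subset_interior
        hx₀t (subset_closure hxt) ?_
      rw [← image_openSegment]
      exact ⟨z, hz, rfl⟩
    refine closure_mono hsub (segment_subset_closure_openSegment (right_mem_segment ℝ _ _))

/-- The induced triangle in `s` over a triangle `t` of `T` projects onto `t`. -/
lemma IsImageTriangulation.image_inter_preimage (hT : IsImageTriangulation K f T)
    (hB : IsConvexPolyhedron B) (hK : IsTriangulationOf K (frontier B))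
    (hfa : IsAffineOnTriangles K f) (hfg : IsGeneralPosition K f) (hs : s ∈ K.faces)
    (hs3 : s.card = 3) (ht : t ∈ T.faces) (ht3 : t.card = 3)
    (h : (f '' convexHull ℝ (s : Set E3) ∩ interior (convexHull ℝ (t : Set E2))).Nonempty) :
    f '' (convexHull ℝ (s : Set E3) ∩ f ⁻¹' convexHull ℝ (t : Set E2)) =
      convexHull ℝ (t : Set E2) := by
  rw [Set.image_inter_preimage, Set.inter_eq_right]
  exact (hT.subset_image hB hK hfa hfg hs hs3 ht ht3 h).1

/-- Overlapping open sets are approximated by the triangles of `T`. -/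
lemma exists_triangle_of_mem_closure (hT : T.faces.Finite) {O : Set E2} (hO : IsOpen O)
    (hOT : O ⊆ T.space) {y : E2} (hy : y ∈ closure O) :
    ∃ t ∈ T.faces, t.card = 3 ∧ y ∈ convexHull ℝ (t : Set E2) ∧
      (O ∩ interior (convexHull ℝ (t : Set E2))).Nonempty := by
  -- The frontiers are nowhere dense, so the interiors of the simplices are dense in `O`. By
  -- finiteness a single simplex has `y` in the closure of its share; its interior being nonempty,
  -- it is a triangle.
  set A : Finset E2 → Set E2 := fun t =>
    frontier (convexHull ℝ (t : Set E2)) with hA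
  have hint : interior (⋃ t ∈ T.faces, A t) = ∅ :=
    interior_biUnion_eq_empty hT (fun t _ => isClosed_frontier)
      fun t _ => interior_frontier (isClosed_convexHull_finset t)
  have hdense : Dense (⋃ t ∈ T.faces, A t)ᶜ := interior_eq_empty_iff_dense_compl.1 hint
  have hcl : y ∈ closure (⋃ t ∈ T.faces, O ∩ interior (convexHull ℝ (t : Set E2))) := by
    have h1 : O ∩ (⋃ t ∈ T.faces, A t)ᶜ ⊆
        ⋃ t ∈ T.faces, O ∩ interior (convexHull ℝ (t : Set E2)) := by
      rintro z ⟨hzO, hz⟩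
      obtain ⟨t, ht, hzt⟩ := Geometry.SimplicialComplex.mem_space_iff.1 (hOT hzO)
      refine Set.mem_biUnion ht ⟨hzO, ?_⟩
      by_contra hzi
      exact hz (Set.mem_biUnion ht ⟨subset_closure hzt, hzi⟩)
    refine closure_mono h1 ?_
    have h2 := hdense.open_subset_closure_inter hO
    exact closure_minimal h2 isClosed_closure hy
  rw [hT.closure_biUnion] at hcl
  obtain ⟨t, ht, hyt⟩ := Set.mem_iUnion₂.1 hcl
  have hne : (O ∩ interior (convexHull ℝ (t : Set E2))).Nonempty :=
    closure_nonempty_iff.1 ⟨y, hyt⟩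
  refine ⟨t, ht, ?_, ?_, hne⟩
  · have h1 := card_le_of_affineIndependent (T.indep ht)
    simp only [finrank_euclideanSpace, Fintype.card_fin] at h1
    by_contra h2
    have h3 : interior (convexHull ℝ (t : Set E2)) = ∅ :=
      interior_convexHull_eq_empty (by simp only [finrank_euclideanSpace, Fintype.card_fin]; omega)
    rw [h3, Set.inter_empty] at hne
    exact Set.not_nonempty_empty hne
  · exact (isClosed_convexHull_finset t).closure_subset
      (closure_mono (Set.inter_subset_right.trans interior_subset) hyt)

/-- The complex of neighbors is the closure of the set of distinct neighbors. -/
theorem neighborComplex_eq_closure (hB : IsConvexPolyhedron B)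
    (hK : IsTriangulationOf K (frontier B)) (hfa : IsAffineOnTriangles K f)
    (hfg : IsGeneralPosition K f) (hT : IsImageTriangulation K f T) :
    neighborComplex K f T = closure (distinctNeighbors (frontier B) f) := by
  rw [closure_distinctNeighbors_eq hB hK hfa hfg]
  have hmeet : ∀ {s : Finset E3} {t : Finset E2},
      (convexHull ℝ (s : Set E3) ∩ f ⁻¹' interior (convexHull ℝ (t : Set E2))).Nonempty →
      (f '' convexHull ℝ (s : Set E3) ∩ interior (convexHull ℝ (t : Set E2))).Nonempty := by
    rintro s t ⟨x, hx, hxt⟩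
    exact ⟨f x, ⟨x, hx, rfl⟩, hxt⟩
  apply Set.Subset.antisymm
  · rintro x ⟨_, ⟨A, ⟨hAne, s, hs, hs3, t, ht, ht3, rfl⟩, A', ⟨hAne', s', hs', hs3', t', ht', ht3',
      rfl⟩, hne, himage, rfl⟩, hx⟩
    rw [closure_nonempty_iff] at hAne hAne'
    rw [closure_inter_preimage_interior hfa hs hs3 hAne,
      closure_inter_preimage_interior hfa hs' hs3' hAne'] at hne himage hx
    rw [hT.image_inter_preimage hB hK hfa hfg hs hs3 ht ht3 (hmeet hAne),
      hT.image_inter_preimage hB hK hfa hfg hs' hs3' ht' ht3' (hmeet hAne')] at himage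
    have hsub := (hT.subset_image hB hK hfa hfg hs hs3 ht ht3 (hmeet hAne)).2
    have hsub' := (hT.subset_image hB hK hfa hfg hs' hs3' ht' ht3' (hmeet hAne')).2
    -- Equality of the projections identifies the triangles below, so one open triangle lies in both
    -- image interiors.
    rw [← himage] at hne hsub'
    have hss' : s ≠ s' := by
      rintro rfl
      exact hne rfl
    refine Set.mem_biUnion (x := (s, s')) ⟨⟨hs, hs3⟩, ⟨hs', hs3'⟩, hss', ?_⟩
      ⟨hx.1.1, hx.2.1.1, hx.2.2⟩
    exact (interior_convexHull_nonempty (T.indep ht) (by simp [ht3])).mono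
      (Set.subset_inter hsub hsub')
  · refine Set.iUnion₂_subset ?_
    rintro ⟨s, s'⟩ ⟨⟨hs, hs3⟩, ⟨hs', hs3'⟩, hne, hO⟩ ⟨a, b⟩ ⟨ha, hb, hab⟩
    simp only at hs hs3 hs' hs3' hne hO ha hb hab
    set I := f '' convexHull ℝ (s : Set E3) with hI
    set I' := f '' convexHull ℝ (s' : Set E3) with hI'
    have hIconv : Convex ℝ I := hfa.convex_image hs hs3
    have hIconv' : Convex ℝ I' := hfa.convex_image hs' hs3'
    obtain ⟨z, hz, hz'⟩ := hO
    -- The point `f a` may lie on the boundary of the overlap; being in its closure suffices for a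
    -- triangle of `T` that contains `f a` and whose interior meets the overlap.
    have hy : f a ∈ closure (interior I ∩ interior I') := by
      have hsub : openSegment ℝ z (f a) ⊆ interior I ∩ interior I' := Set.subset_inter
        (hIconv.openSegment_interior_closure_subset_interior hz (subset_closure ⟨a, ha, rfl⟩))
        (hIconv'.openSegment_interior_closure_subset_interior hz'
          (subset_closure ⟨b, hb, hab.symm⟩))
      exact closure_mono hsub (segment_subset_closure_openSegment (right_mem_segment ℝ _ _))
    have hspace : interior I ∩ interior I' ⊆ T.space := by
      rw [hT.space_eq]
      exact (Set.inter_subset_left.trans interior_subset).trans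
        (Set.image_mono (K.convexHull_subset_space hs))
    obtain ⟨t, ht, ht3, hyt, y, ⟨hyI, hyI'⟩, hyt'⟩ := exists_triangle_of_mem_closure hT.finite
      (isOpen_interior.inter isOpen_interior) hspace hy
    have hm : (I ∩ interior (convexHull ℝ (t : Set E2))).Nonempty := ⟨y, interior_subset hyI, hyt'⟩
    have hm' : (I' ∩ interior (convexHull ℝ (t : Set E2))).Nonempty :=
      ⟨y, interior_subset hyI', hyt'⟩
    have hne₁ : (convexHull ℝ (s : Set E3) ∩
        f ⁻¹' interior (convexHull ℝ (t : Set E2))).Nonempty := by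
      obtain ⟨x, hx, hxy⟩ := interior_subset hyI
      exact ⟨x, hx, by rwa [Set.mem_preimage, hxy]⟩
    have hne₂ : (convexHull ℝ (s' : Set E3) ∩
        f ⁻¹' interior (convexHull ℝ (t : Set E2))).Nonempty := by
      obtain ⟨x, hx, hxy⟩ := interior_subset hyI'
      exact ⟨x, hx, by rwa [Set.mem_preimage, hxy]⟩
    have e₁ := closure_inter_preimage_interior hfa hs hs3 hne₁
    have e₂ := closure_inter_preimage_interior hfa hs' hs3' hne₂
    have i₁ := hT.image_inter_preimage hB hK hfa hfg hs hs3 ht ht3 hm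
    have i₂ := hT.image_inter_preimage hB hK hfa hfg hs' hs3' ht ht3 hm'
    refine ⟨_, ⟨_, ⟨hne₁.closure, s, hs, hs3, t, ht, ht3, rfl⟩, _,
      ⟨hne₂.closure, s', hs', hs3', t, ht, ht3, rfl⟩, ?_, ?_, rfl⟩, ?_⟩
    · rw [e₁, e₂]
      intro h
      -- If the induced triangles coincided, they would lie in the common face of `s` and `s'`,
      -- whose image is too thin to contain `t`.
      have hsub : convexHull ℝ (t : Set E2) ⊆
          f '' (convexHull ℝ (s : Set E3) ∩ convexHull ℝ (s' : Set E3)) := by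
        rw [← i₁]
        exact Set.image_mono fun x hx => ⟨hx.1, (h ▸ hx : x ∈ convexHull ℝ (s' : Set E3) ∩ _).1⟩
      have h1 := interior_mono hsub hyt'
      rw [interior_image_inter_eq_empty hfa hs hs3 hs' hs3' hne] at h1
      exact h1
    · rw [e₁, e₂, i₁, i₂]
    · rw [e₁, e₂]
      exact ⟨⟨ha, hyt⟩, ⟨hb, by rw [Set.mem_preimage, ← hab]; exact hyt⟩, hab⟩

end ImageTriangulation

end DiscreteHopf

theorem theorem4 (B : Set DiscreteHopf.E3) (hB : DiscreteHopf.IsConvexPolyhedron B)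
    (K : Geometry.SimplicialComplex ℝ DiscreteHopf.E3)
    (hK : DiscreteHopf.IsTriangulationOf K (frontier B))
    (d : MetricSpace (frontier B))
    (hd : d.toPseudoMetricSpace.toUniformSpace.toTopologicalSpace = instTopologicalSpaceSubtype)
    (f : DiscreteHopf.E3 → DiscreteHopf.E2) (hf : ContinuousOn f (frontier B))
    (hfa : DiscreteHopf.IsAffineOnTriangles K f)
    (hfg : DiscreteHopf.IsGeneralPosition K f) :
    (∀ T, DiscreteHopf.IsImageTriangulation K f T → ∀ p, DiscreteHopf.IsCenter B d p →
      DiscreteHopf.JoinsAntipodalToDiagonal B p (DiscreteHopf.neighborComplex K f T)) ∧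
    (∀ T, DiscreteHopf.IsImageTriangulation K f T →
      DiscreteHopf.neighborComplex K f T =
        closure (DiscreteHopf.distinctNeighbors (frontier B) f)) ∧
    (∀ p ∈ interior B, DiscreteHopf.JoinsAntipodalToDiagonal B p
      (closure (DiscreteHopf.distinctNeighbors (frontier B) f))) := by
  have h₂ : ∀ T, DiscreteHopf.IsImageTriangulation K f T →
      DiscreteHopf.neighborComplex K f T =
        closure (DiscreteHopf.distinctNeighbors (frontier B) f) := fun T hT =>
    DiscreteHopf.neighborComplex_eq_closure hB hK hfa hfg hT
  have h₃ : ∀ p ∈ interior B, DiscreteHopf.JoinsAntipodalToDiagonal B p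
      (closure (DiscreteHopf.distinctNeighbors (frontier B) f)) := fun p hp =>
    DiscreteHopf.joinsAntipodalToDiagonal_closure hB hK hf hfa hfg hp
  -- A center is an interior point, so the first claim is the third one transported by the second.
  refine ⟨fun T hT p hp => ?_, h₂, h₃⟩
  rw [h₂ T hT]
  exact h₃ p hp.1
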